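/- Let $(M,g)$ be a closed (compact, without boundary) smooth Riemannian manifold of dimension $n$, not necessarily connected, with Levi-Civita connection $\nabla$, Riemann curvature $R_{ijk\ell}=\langle \mathrm{Rm}(\partial_i,\partial_j)\partial_k,\partial_\ell\rangle$, where $\mathrm{Rm}(X,Y)Z=\nabla_X\nabla_YZ-\nabla_Y\nabla_XZ-\nabla_{[X,Y]}Z$, scalar curvature $R=g^{jk}g^{i\ell}R_{ijk\ell}$, Laplacian $\Delta=g^{ij}\nabla_i\nabla_j$ and Riemannian volume measure $dV$, and let $u$ be a smooth real function on $M$. Put $$R^{\mathbf L}_{ijk\ell}:=R_{ijk\ell}-\nabla_iu\nabla_ku\,g_{j\ell}-\nabla_iu\nabla_ju\,g_{k\ell},\qquad R^{\mathbf L}:=g^{jk}g^{i\ell}R^{\mathbf L}_{ijk\ell},$$ let $R^{\mathbf{WY}}_{ijk\ell}:=\langle \mathrm{Rm}^u(\partial_i,\partial_j)\partial_k,\partial_\ell\rangle$, where $\mathrm{Rm}^u$ is the curvature of the connection $\nabla^u_XY:=\nabla_XY-(Yu)X-(Xu)Y$, and put $R^{\mathbf{WY}}:=g^{jk}g^{i\ell}R^{\mathbf{WY}}_{ijk\ell}$.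 Then $$R^{\mathbf L}=R-2|\nabla u|^2,\qquad R^{\mathbf{WY}}=R+(n-1)\left(|\nabla u|^2+\Delta u\right)$$ pointwise on $M$, and the following hold. 1. For every Borel measure $\mu$ on $M$ for which $R^{\mathbf L}$ and $R$ are integrable (in particular for every finite Borel measure $\mu$), $$\int_M R^{\mathbf L}\,d\mu\le\int_M R\,d\mu .$$ 2. $R$ and $R^{\mathbf{WY}}$ are $dV$-integrable, and $\displaystyle\int_M R\,dV\le\int_M R^{\mathbf{WY}}\,dV$. 3. $R\,e^u$ and $R^{\mathbf{WY}}e^u$ are $dV$-integrable, and $\displaystyle\int_M R\,e^u\,dV=\int_M R^{\mathbf{WY}}e^u\,dV$. -/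

import Mathlib

open scoped Manifold ContDiff
open MeasureTheory

noncomputable section

namespace WeightedScalar

/-- A smooth Riemannian metric on an `n`-dimensional smooth manifold `M` without boundary. -/
abbrev SmoothMetric (n : ℕ) (M : Type*) [TopologicalSpace M]
    [ChartedSpace (EuclideanSpace ℝ (Fin n)) M] [IsManifold (𝓡 n) ∞ M] :=
  Bundle.ContMDiffRiemannianMetric (𝓡 n) ∞ (EuclideanSpace ℝ (Fin n))
    (fun x : M => TangentSpace (𝓡 n) x)

variable {n : ℕ}

/-- The partial derivative `∂ᵢ F` at `y` of a function of the coordinates `y ∈ ℝⁿ`. -/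
def partialDeriv (i : Fin n) (F : EuclideanSpace ℝ (Fin n) → ℝ)
    (y : EuclideanSpace ℝ (Fin n)) : ℝ :=
  fderiv ℝ F y (EuclideanSpace.single i 1)

/-! ### Connections and curvature in coordinates

A connection is given in a chart by its coefficients `Γ y i j k`, where
`∇_{∂ᵢ} ∂ⱼ = ∑ₖ Γ y i j k ∂ₖ` at the point with coordinates `y`. -/

/-- The curvature of a connection: `R^m_{ijk}`, the coefficient of `∂ₘ` in
`Rm(∂ᵢ, ∂ⱼ) ∂ₖ = ∇_{∂ᵢ} ∇_{∂ⱼ} ∂ₖ - ∇_{∂ⱼ} ∇_{∂ᵢ} ∂ₖ`. -/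
def connCurvature (Γ : EuclideanSpace ℝ (Fin n) → Fin n → Fin n → Fin n → ℝ)
    (y : EuclideanSpace ℝ (Fin n)) (i j k m : Fin n) : ℝ :=
  partialDeriv i (fun z => Γ z j k m) y - partialDeriv j (fun z => Γ z i k m) y
    + ∑ p, (Γ y j k p * Γ y i p m - Γ y i k p * Γ y j p m)

/-- The covariant curvature `R_{ijkl} = ⟨Rm(∂ᵢ, ∂ⱼ) ∂ₖ, ∂ₗ⟩` of a connection, for the metric with
coefficients `G`. -/
def connCurvatureLow (G : EuclideanSpace ℝ (Fin n) → Matrix (Fin n) (Fin n) ℝ)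
    (Γ : EuclideanSpace ℝ (Fin n) → Fin n → Fin n → Fin n → ℝ)
    (y : EuclideanSpace ℝ (Fin n)) (i j k l : Fin n) : ℝ :=
  ∑ m, G y m l * connCurvature Γ y i j k m

/-- The Ricci contraction `T_{jk} = g^{il} T_{ijkl}`; `A` is a metric at one point. -/
def ricciContraction (A : Matrix (Fin n) (Fin n) ℝ) (T : Fin n → Fin n → Fin n → Fin n → ℝ)
    (j k : Fin n) : ℝ :=
  ∑ i, ∑ l, A⁻¹ i l * T i j k l

/-- The scalar contraction `g^{jk} T_{jk}` of the Ricci contraction of `T`. -/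
def scalarContraction (A : Matrix (Fin n) (Fin n) ℝ)
    (T : Fin n → Fin n → Fin n → Fin n → ℝ) : ℝ :=
  ∑ j, ∑ k, A⁻¹ j k * ricciContraction A T j k

variable {M : Type*} [TopologicalSpace M] [ChartedSpace (EuclideanSpace ℝ (Fin n)) M]
  [IsManifold (𝓡 n) ∞ M]

/-- The coordinate vector field `∂ᵢ` of the chart `φ`, at the point `φ⁻¹ y`. -/
def coordVector (φ : OpenPartialHomeomorph M (EuclideanSpace ℝ (Fin n)))
    (y : EuclideanSpace ℝ (Fin n)) (i : Fin n) : TangentSpace (𝓡 n) (φ.symm y) :=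
  mfderiv (𝓡 n) (𝓡 n) φ.symm y (EuclideanSpace.single i 1 : EuclideanSpace ℝ (Fin n))

/-- The coefficients `g_{ij} = g(∂ᵢ, ∂ⱼ)` of the metric in the chart `φ`. -/
def metricCoeff (g : SmoothMetric n M) (φ : OpenPartialHomeomorph M (EuclideanSpace ℝ (Fin n)))
    (y : EuclideanSpace ℝ (Fin n)) : Matrix (Fin n) (Fin n) ℝ :=
  Matrix.of fun i j => g.inner (φ.symm y) (coordVector φ y i) (coordVector φ y j)

/-- The Christoffel symbols `Γ^k_{ij}` of the Levi-Civita connection in the chart `φ`. -/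
def christoffel (g : SmoothMetric n M) (φ : OpenPartialHomeomorph M (EuclideanSpace ℝ (Fin n)))
    (y : EuclideanSpace ℝ (Fin n)) (i j k : Fin n) : ℝ :=
  (1 / 2 : ℝ) * ∑ l, (metricCoeff g φ y)⁻¹ k l *
    (partialDeriv i (fun z => metricCoeff g φ z j l) y
      + partialDeriv j (fun z => metricCoeff g φ z i l) y
      - partialDeriv l (fun z => metricCoeff g φ z i j) y)

/-- The component `∇ᵢ u = ∂ᵢ u` of `du` in the chart `φ`. -/
def duCoeff (u : M → ℝ) (φ : OpenPartialHomeomorph M (EuclideanSpace ℝ (Fin n)))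
    (y : EuclideanSpace ℝ (Fin n)) (i : Fin n) : ℝ :=
  partialDeriv i (fun z => u (φ.symm z)) y

/-- The component `∇ᵢ∇ⱼ u = ∂ᵢ∂ⱼ u - Γ^k_{ij} ∂ₖ u` of the Hessian in the chart `φ`. -/
def hessCoeff (g : SmoothMetric n M) (u : M → ℝ)
    (φ : OpenPartialHomeomorph M (EuclideanSpace ℝ (Fin n)))
    (y : EuclideanSpace ℝ (Fin n)) (i j : Fin n) : ℝ :=
  partialDeriv i (fun z => duCoeff u φ z j) y - ∑ k, christoffel g φ y i j k * duCoeff u φ y k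

/-- The coefficients in the chart `φ` of the Wylie-Yeroshkin weighted connection
`∇^u_X Y = ∇_X Y - (Y u) X - (X u) Y`. -/
def weightedChristoffel (g : SmoothMetric n M) (u : M → ℝ)
    (φ : OpenPartialHomeomorph M (EuclideanSpace ℝ (Fin n)))
    (y : EuclideanSpace ℝ (Fin n)) (i j k : Fin n) : ℝ :=
  christoffel g φ y i j k - duCoeff u φ y j * (if k = i then 1 else 0)
    - duCoeff u φ y i * (if k = j then 1 else 0)

/-- The Riemann curvature `R_{ijkl}` of `g` in the chart `φ`. -/
def riemCoeff (g : SmoothMetric n M) (φ : OpenPartialHomeomorph M (EuclideanSpace ℝ (Fin n)))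
    (y : EuclideanSpace ℝ (Fin n)) : Fin n → Fin n → Fin n → Fin n → ℝ :=
  connCurvatureLow (metricCoeff g φ) (christoffel g φ) y

/-- `R^L_{ijkl} = R_{ijkl} - ∇ᵢu ∇ₖu g_{jl} - ∇ᵢu ∇ⱼu g_{kl}` in the chart `φ`. -/
def riemLCoeff (g : SmoothMetric n M) (u : M → ℝ)
    (φ : OpenPartialHomeomorph M (EuclideanSpace ℝ (Fin n)))
    (y : EuclideanSpace ℝ (Fin n)) (i j k l : Fin n) : ℝ :=
  riemCoeff g φ y i j k l - duCoeff u φ y i * duCoeff u φ y k * metricCoeff g φ y j l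
    - duCoeff u φ y i * duCoeff u φ y j * metricCoeff g φ y k l

/-- `R^{WY}_{ijkl}`, the curvature of the weighted connection `∇^u`, in the chart `φ`. -/
def riemWYCoeff (g : SmoothMetric n M) (u : M → ℝ)
    (φ : OpenPartialHomeomorph M (EuclideanSpace ℝ (Fin n)))
    (y : EuclideanSpace ℝ (Fin n)) : Fin n → Fin n → Fin n → Fin n → ℝ :=
  connCurvatureLow (metricCoeff g φ) (weightedChristoffel g u φ) y

/-! ### Scalar quantities on the manifold

All of them are full contractions of tensor fields, so that they do not depend on the chart; at the
point `p` they are computed in the preferred chart `chartAt _ p` there. -/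

/-- The scalar curvature `R = g^{jk} g^{il} R_{ijkl}`. -/
def scalarCurv (g : SmoothMetric n M) (p : M) : ℝ :=
  let φ := chartAt (EuclideanSpace ℝ (Fin n)) p
  scalarContraction (metricCoeff g φ (φ p)) (riemCoeff g φ (φ p))

/-- The scalar curvature `R^L = g^{jk} g^{il} R^L_{ijkl}`. -/
def scalarCurvL (g : SmoothMetric n M) (u : M → ℝ) (p : M) : ℝ :=
  let φ := chartAt (EuclideanSpace ℝ (Fin n)) p
  scalarContraction (metricCoeff g φ (φ p)) (riemLCoeff g u φ (φ p))

/-- The scalar curvature `R^{WY} = g^{jk} g^{il} R^{WY}_{ijkl}`. -/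
def scalarCurvWY (g : SmoothMetric n M) (u : M → ℝ) (p : M) : ℝ :=
  let φ := chartAt (EuclideanSpace ℝ (Fin n)) p
  scalarContraction (metricCoeff g φ (φ p)) (riemWYCoeff g u φ (φ p))

/-- `|∇u|² = g^{ij} ∇ᵢu ∇ⱼu`. -/
def gradNormSq (g : SmoothMetric n M) (u : M → ℝ) (p : M) : ℝ :=
  let φ := chartAt (EuclideanSpace ℝ (Fin n)) p
  ∑ i, ∑ j, (metricCoeff g φ (φ p))⁻¹ i j * (duCoeff u φ (φ p) i * duCoeff u φ (φ p) j)

/-- The Laplace-Beltrami operator `Δu = g^{ij} ∇ᵢ∇ⱼu`. -/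
def laplacian (g : SmoothMetric n M) (u : M → ℝ) (p : M) : ℝ :=
  let φ := chartAt (EuclideanSpace ℝ (Fin n)) p
  ∑ i, ∑ j, (metricCoeff g φ (φ p))⁻¹ i j * hessCoeff g u φ (φ p) i j

/-! ### The Riemannian volume measure -/

section Volume

variable [T2Space M] [SigmaCompactSpace M]

variable (n M) in
/-- A smooth partition of unity subordinate to the domains of the preferred charts. -/
def chartPartition : SmoothPartitionOfUnity M (𝓡 n) M Set.univ :=
  Classical.choose (SmoothPartitionOfUnity.exists_isSubordinate_chartAt_source (𝓡 n) M)

variable (n M) in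
lemma chartPartition_isSubordinate :
    (chartPartition n M).IsSubordinate
      (fun x : M => (chartAt (EuclideanSpace ℝ (Fin n)) x).source) :=
  Classical.choose_spec (SmoothPartitionOfUnity.exists_isSubordinate_chartAt_source (𝓡 n) M)

/-- The Riemannian volume measure `dV = √(det g_{ij}) dy¹⋯dyⁿ`, glued from the charts by a partition
of unity `ρ`: `∫ f dV = ∑_c ∫_{φ_c(U_c)} (ρ_c f)(φ_c⁻¹ y) √(det g_{ij}(y)) dy`. -/
def riemannianVolume [MeasurableSpace M] (g : SmoothMetric n M) : Measure M :=
  Measure.sum fun c : M =>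
    let φ := chartAt (EuclideanSpace ℝ (Fin n)) c
    Measure.map φ.symm ((volume.restrict φ.target).withDensity fun y =>
      ENNReal.ofReal (chartPartition n M c (φ.symm y) * √(metricCoeff g φ y).det))

end Volume

end WeightedScalar

end

/-! The two pointwise formulas are linear algebra. In `R^L` each correction term carries a metric
factor that cancels one inverse metric, so each contributes `-|∇u|²`. For the weighted connection
put `Q = Hess u + du ⊗ du`; its curvature is `Rm(x, v)w + Q(v, w)x - Q(x, w)v`, and tracing over `x`
adds `(n - 1) Q(v, w)` to the Ricci form.

The first inequality is then `|∇u|² ≥ 0`. The other two integral statements rest on `∫ Δf dV = 0`: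
taking `f = u` leaves `(n - 1) ∫ |∇u|² dV`, and taking `f = exp u` gives the equality, because
`Δ(exp u) = (|∇u|² + Δu) exp u`.

The bulk of the work is chart independence. The scalar quantities are evaluated at `p` in the
preferred chart at `p`, which may jump with `p`, and the volume is glued by a partition of unity.
Continuity, and integration by parts in a single chart, therefore need formulas valid in every
chart. Transition maps are isometries of the coordinate metrics. The Koszul formula forces the
Levi-Civita coefficients to transform with the usual second-derivative term (`koszul_transform`);
this makes curvature and Hessian tensorial (`curvatureAt_transform`, `IsIsometryOn.localLaplacian`),
and full contractions of tensors are invariant (`contraction_transform`). The Jacobian rule for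
`√det g` does the same for the volume (`lintegral_chart_eq`).

Finally `√det g Δf` is the coordinate divergence of `√det g g^{ij} ∂ⱼf`
(`sqrt_det_mul_localLaplacian`), so it integrates to zero when `f` is supported in a chart; a
partition of unity gives the general case. -/

noncomputable section

namespace WeightedScalar

open Filter Topology

variable {n : ℕ}

local notation "𝔼" => EuclideanSpace ℝ (Fin n)

/-! ### Transformation laws for connections and curvature, without indices -/

section Transformation

variable {E F : Type*} [NormedAddCommGroup E] [NormedSpace ℝ E] [NormedAddCommGroup F]
  [NormedSpace ℝ F]

/-- The curvature `R(x, v) w` of the connection on `E` with coefficients `C`. -/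
def curvatureAt (C : E → E →L[ℝ] E →L[ℝ] E) (y x v w : E) : E :=
  fderiv ℝ C y x v w - fderiv ℝ C y v x w + C y x (C y v w) - C y v (C y x w)

lemma fderiv_apply₂ {G : Type*} [NormedAddCommGroup G] [NormedSpace ℝ G]
    {B : E → E →L[ℝ] E →L[ℝ] G} {y : E} (hB : DifferentiableAt ℝ B y) (x v w : E) :
    fderiv ℝ (fun z => B z v w) y x = fderiv ℝ B y x v w := by
  have h := ((hB.hasFDerivAt.clm_apply (hasFDerivAt_const v y)).clm_apply (hasFDerivAt_const w y))
  rw [h.fderiv]; simp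

/-- A connection that satisfies the Koszul formula transforms like the Levi-Civita connection. -/
theorem koszul_transform {B : E → E →L[ℝ] E →L[ℝ] ℝ} {B' : F → F →L[ℝ] F →L[ℝ] ℝ}
    {C : E →L[ℝ] E →L[ℝ] E} {C' : F →L[ℝ] F →L[ℝ] F} {ψ : E → F} {y : E}
    (hψ : ContDiffAt ℝ 2 ψ y) (hBd : DifferentiableAt ℝ B y)
    (hBd' : DifferentiableAt ℝ B' (ψ y))
    (hB : ∀ᶠ z in 𝓝 y, ∀ v w, B z v w = B' (ψ z) (fderiv ℝ ψ z v) (fderiv ℝ ψ z w))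
    (hsymm : ∀ v w, B' (ψ y) v w = B' (ψ y) w v)
    (hC : ∀ u v w, 2 * B y (C u v) w =
      fderiv ℝ B y u v w + fderiv ℝ B y v u w - fderiv ℝ B y w u v)
    (hC' : ∀ u v w, 2 * B' (ψ y) (C' u v) w =
      fderiv ℝ B' (ψ y) u v w + fderiv ℝ B' (ψ y) v u w - fderiv ℝ B' (ψ y) w u v)
    (hnd : ∀ v, (∀ w, B' (ψ y) v (fderiv ℝ ψ y w) = 0) → v = 0) (u v : E) :
    fderiv ℝ ψ y (C u v) =
      fderiv ℝ (fderiv ℝ ψ) y u v + C' (fderiv ℝ ψ y u) (fderiv ℝ ψ y v) := by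
  have hdψ : DifferentiableAt ℝ (fderiv ℝ ψ) y :=
    (hψ.fderiv_right (m := 1) (by norm_num)).differentiableAt (by norm_num)
  have hsm : IsSymmSndFDerivAt ℝ ψ y := hψ.isSymmSndFDerivAt (by simp)
  have hD : ∀ x v w, fderiv ℝ B y x v w =
      fderiv ℝ B' (ψ y) (fderiv ℝ ψ y x) (fderiv ℝ ψ y v) (fderiv ℝ ψ y w)
      + B' (ψ y) (fderiv ℝ (fderiv ℝ ψ) y x v) (fderiv ℝ ψ y w)
      + B' (ψ y) (fderiv ℝ ψ y v) (fderiv ℝ (fderiv ℝ ψ) y x w) := by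
    intro x v w
    rw [← fderiv_apply₂ hBd]
    have he : (fun z => B z v w) =ᶠ[𝓝 y]
        fun z => B' (ψ z) (fderiv ℝ ψ z v) (fderiv ℝ ψ z w) := hB.mono fun z hz => hz v w
    rw [he.fderiv_eq]
    have h1 : HasFDerivAt (fun z => B' (ψ z))
        ((fderiv ℝ B' (ψ y)).comp (fderiv ℝ ψ y)) y :=
      HasFDerivAt.comp (g := B') (f := ψ) y hBd'.hasFDerivAt
        (hψ.differentiableAt (by norm_num)).hasFDerivAt
    have h2 := fun v => hdψ.hasFDerivAt.clm_apply (hasFDerivAt_const v y)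
    rw [((h1.clm_apply (h2 v)).clm_apply (h2 w)).fderiv]
    simp
    ring
  rw [← sub_eq_zero]
  refine hnd _ fun w => ?_
  have h0 := hC u v w
  have h1 := hC' (fderiv ℝ ψ y u) (fderiv ℝ ψ y v) (fderiv ℝ ψ y w)
  rw [hB.self_of_nhds, hD, hD, hD] at h0
  simp only [map_sub, map_add, _root_.sub_apply, _root_.add_apply]
  -- Of the six terms with a second derivative of `ψ`, four cancel in the Koszul combination by
  -- symmetry, and the other two give `2 B'(D²ψ(u, v), dψ w)`.
  rw [hsm.eq v u, hsm.eq w u, hsm.eq w v, hsymm (fderiv ℝ (fderiv ℝ ψ) y u w)] at h0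
  linarith [hsymm (fderiv ℝ (fderiv ℝ ψ) y v w) (fderiv ℝ ψ y u)]

/-- The curvature is natural under connection preserving changes of coordinates. -/
theorem curvatureAt_transform {C : E → E →L[ℝ] E →L[ℝ] E} {C' : F → F →L[ℝ] F →L[ℝ] F}
    {ψ : E → F} {y : E} (hψ : ContDiffAt ℝ 3 ψ y) (hC : DifferentiableAt ℝ C y)
    (hC' : DifferentiableAt ℝ C' (ψ y))
    (h : ∀ᶠ z in 𝓝 y, ∀ u v, fderiv ℝ ψ z (C z u v) =
      fderiv ℝ (fderiv ℝ ψ) z u v + C' (ψ z) (fderiv ℝ ψ z u) (fderiv ℝ ψ z v)) (x v w : E) :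
    fderiv ℝ ψ y (curvatureAt C y x v w) =
      curvatureAt C' (ψ y) (fderiv ℝ ψ y x) (fderiv ℝ ψ y v) (fderiv ℝ ψ y w) := by
  have hdψ' : ContDiffAt ℝ 2 (fderiv ℝ ψ) y := hψ.fderiv_right (m := 2) (by norm_num)
  have hdψ : DifferentiableAt ℝ (fderiv ℝ ψ) y := hdψ'.differentiableAt (by norm_num)
  have hddψ : DifferentiableAt ℝ (fderiv ℝ (fderiv ℝ ψ)) y :=
    (hdψ'.fderiv_right (m := 1) (by norm_num)).differentiableAt (by norm_num)
  have hsm : IsSymmSndFDerivAt ℝ ψ y := hψ.isSymmSndFDerivAt (by simp; norm_num)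
  have hsm' : IsSymmSndFDerivAt ℝ (fderiv ℝ ψ) y := hdψ'.isSymmSndFDerivAt (by simp)
  -- This is the transformation law differentiated in the direction `x`.
  have hD : ∀ x v w, fderiv ℝ (fderiv ℝ ψ) y x (C y v w) + fderiv ℝ ψ y (fderiv ℝ C y x v w) =
      fderiv ℝ (fderiv ℝ (fderiv ℝ ψ)) y x v w
      + fderiv ℝ C' (ψ y) (fderiv ℝ ψ y x) (fderiv ℝ ψ y v) (fderiv ℝ ψ y w)
      + C' (ψ y) (fderiv ℝ (fderiv ℝ ψ) y x v) (fderiv ℝ ψ y w)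
      + C' (ψ y) (fderiv ℝ ψ y v) (fderiv ℝ (fderiv ℝ ψ) y x w) := by
    intro x v w
    have he : (fun z => fderiv ℝ ψ z (C z v w)) =ᶠ[𝓝 y] fun z =>
        fderiv ℝ (fderiv ℝ ψ) z v w + C' (ψ z) (fderiv ℝ ψ z v) (fderiv ℝ ψ z w) :=
      h.mono fun z hz => hz v w
    have h1 : HasFDerivAt (fun z => C' (ψ z))
        ((fderiv ℝ C' (ψ y)).comp (fderiv ℝ ψ y)) y :=
      HasFDerivAt.comp (g := C') (f := ψ) y hC'.hasFDerivAt
        (hψ.differentiableAt (by norm_num)).hasFDerivAt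
    have h2 := fun v => hdψ.hasFDerivAt.clm_apply (hasFDerivAt_const v y)
    have h3 := (hC.hasFDerivAt.clm_apply (hasFDerivAt_const v y)).clm_apply (hasFDerivAt_const w y)
    have h4 := (hddψ.hasFDerivAt.clm_apply (hasFDerivAt_const v y)).clm_apply
      (hasFDerivAt_const w y)
    have hl := hdψ.hasFDerivAt.clm_apply h3
    have hr := h4.add ((h1.clm_apply (h2 v)).clm_apply (h2 w))
    have := (hl.congr_of_eventuallyEq he.symm).unique hr
    have := DFunLike.congr_fun this x
    simp at this
    rw [add_comm, this]
    abel
  have h0 := h.self_of_nhds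
  have e1 := hD x v w
  have e2 := hD v x w
  -- Antisymmetrising in `x, v` kills `D³ψ(x, v, w)` and `C'(D²ψ(x, v), dψ w)`. The remaining second
  -- derivatives cancel against those produced by the quadratic terms of the curvature.
  rw [hsm'.eq v x, hsm.eq v x] at e2
  have e1' := eq_sub_of_add_eq' e1
  have e2' := eq_sub_of_add_eq' e2
  simp only [curvatureAt, map_sub, map_add, h0]
  rw [e1', e2']
  abel

/-- The curvature of the connection `∇_X Y - (Y u) X - (X u) Y`. -/
theorem curvatureAt_weighted {C : E → E →L[ℝ] E →L[ℝ] E} {W : E → E →L[ℝ] E →L[ℝ] E} {f : E → ℝ}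
    {y : E} (hf : ContDiffAt ℝ 2 f y) (hC : DifferentiableAt ℝ C y) (hWd : DifferentiableAt ℝ W y)
    (hsymm : ∀ v w, C y v w = C y w v)
    (hW : ∀ᶠ z in 𝓝 y, ∀ v w, W z v w = C z v w - fderiv ℝ f z w • v - fderiv ℝ f z v • w)
    (x v w : E) :
    curvatureAt W y x v w = curvatureAt C y x v w
      + (fderiv ℝ (fderiv ℝ f) y v w - fderiv ℝ f y (C y v w)
          + fderiv ℝ f y v * fderiv ℝ f y w) • x
      - (fderiv ℝ (fderiv ℝ f) y x w - fderiv ℝ f y (C y x w)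
          + fderiv ℝ f y x * fderiv ℝ f y w) • v := by
  have hdf : DifferentiableAt ℝ (fderiv ℝ f) y :=
    (hf.fderiv_right (m := 1) (by norm_num)).differentiableAt (by norm_num)
  have hsm : IsSymmSndFDerivAt ℝ f y := hf.isSymmSndFDerivAt (by simp)
  have hD : ∀ x v w, fderiv ℝ W y x v w = fderiv ℝ C y x v w
      - fderiv ℝ (fderiv ℝ f) y x w • v - fderiv ℝ (fderiv ℝ f) y x v • w := by
    intro x v w
    rw [← fderiv_apply₂ hWd]
    have he : (fun z => W z v w) =ᶠ[𝓝 y]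
        fun z => C z v w - fderiv ℝ f z w • v - fderiv ℝ f z v • w := hW.mono fun z hz => hz v w
    have h1 := (hC.hasFDerivAt.clm_apply (hasFDerivAt_const v y)).clm_apply (hasFDerivAt_const w y)
    have h2 := fun v => hdf.hasFDerivAt.clm_apply (hasFDerivAt_const v y)
    have h3 := (h1.sub ((h2 w).smul_const v)).sub ((h2 v).smul_const w)
    rw [(h3.congr_of_eventuallyEq he).fderiv]
    simp
  simp only [curvatureAt, hD, hW.self_of_nhds, map_sub, map_smul, smul_eq_mul]
  -- Symmetry of `D²f` removes the component along `w`; vanishing torsion removes `df(w) (C(x, v) -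
  -- C(v, x))`.
  rw [hsm.eq v x, hsymm v x]
  module

end Transformation

/-! ### Coefficients as bilinear maps, and contractions -/

section Coordinates

/-- The `i`-th coordinate vector of `ℝⁿ`. -/
abbrev stdVec (i : Fin n) : EuclideanSpace ℝ (Fin n) := EuclideanSpace.single i 1

lemma sum_smul_stdVec (v : 𝔼) : ∑ i, v i • stdVec i = v := by
  ext j
  simp [stdVec, Pi.single_apply]

/-- The bilinear form with given coefficients. -/
def bilinForm (A : Matrix (Fin n) (Fin n) ℝ) : 𝔼 →L[ℝ] 𝔼 →L[ℝ] ℝ :=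
  ∑ i, ∑ j, A i j • (EuclideanSpace.proj i : 𝔼 →L[ℝ] ℝ).smulRight
    (EuclideanSpace.proj j : 𝔼 →L[ℝ] ℝ)

/-- The bilinear map `(v, w) ↦ Γ(v, w)` with given coefficients. -/
def bilinMap (Γ : Fin n → Fin n → Fin n → ℝ) : 𝔼 →L[ℝ] 𝔼 →L[ℝ] 𝔼 :=
  ∑ i, ∑ j, ∑ k, Γ i j k • (EuclideanSpace.proj i : 𝔼 →L[ℝ] ℝ).smulRight
    ((EuclideanSpace.proj j : 𝔼 →L[ℝ] ℝ).smulRight (stdVec k))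

lemma bilinForm_apply (A : Matrix (Fin n) (Fin n) ℝ) (v w : 𝔼) :
    bilinForm A v w = ∑ i, ∑ j, A i j * (v i * w j) := by
  simp [bilinForm, _root_.sum_apply]

lemma star_dotProduct_mulVec (A : Matrix (Fin n) (Fin n) ℝ) (x : Fin n → ℝ) :
    star x ⬝ᵥ A.mulVec x = bilinForm A (WithLp.toLp 2 x) (WithLp.toLp 2 x) := by
  rw [bilinForm_apply]
  simp only [dotProduct, Matrix.mulVec, Finset.mul_sum, star_trivial]
  exact Finset.sum_congr rfl fun i _ => Finset.sum_congr rfl fun j _ => by ring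

@[simp] lemma bilinForm_stdVec (A : Matrix (Fin n) (Fin n) ℝ) (i j : Fin n) :
    bilinForm A (stdVec i) (stdVec j) = A i j := by
  simp [bilinForm_apply, stdVec]

lemma bilinMap_apply (Γ : Fin n → Fin n → Fin n → ℝ) (v w : 𝔼) (k : Fin n) :
    bilinMap Γ v w k = ∑ i, ∑ j, Γ i j k * (v i * w j) := by
  simp [bilinMap, _root_.sum_apply, stdVec, Pi.single_apply]

@[simp] lemma bilinMap_stdVec (Γ : Fin n → Fin n → Fin n → ℝ) (i j k : Fin n) :
    bilinMap Γ (stdVec i) (stdVec j) k = Γ i j k := by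
  simp [bilinMap_apply, stdVec]

lemma clm_ext {G : Type*} [NormedAddCommGroup G] [NormedSpace ℝ G] {f g : 𝔼 →L[ℝ] G}
    (h : ∀ i, f (stdVec i) = g (stdVec i)) : f = g := by
  ext v
  rw [← sum_smul_stdVec v, map_sum, map_sum]
  simp [h]

lemma clm_ext₂ {G : Type*} [NormedAddCommGroup G] [NormedSpace ℝ G] {f g : 𝔼 →L[ℝ] 𝔼 →L[ℝ] G}
    (h : ∀ i j, f (stdVec i) (stdVec j) = g (stdVec i) (stdVec j)) : f = g :=
  clm_ext fun i => clm_ext (h i)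

lemma vec_induction {P : 𝔼 → Prop} (hstd : ∀ i, P (stdVec i)) (hzero : P 0)
    (hadd : ∀ v w, P v → P w → P (v + w)) (hsmul : ∀ (c : ℝ) v, P v → P (c • v)) (v : 𝔼) :
    P v := by
  rw [← sum_smul_stdVec v]
  exact Finset.sum_induction _ P hadd hzero fun i _ => hsmul _ _ (hstd i)

/-- The full contraction `g^{jk} T_{jk}` of a bilinear form. -/
def contraction (A : Matrix (Fin n) (Fin n) ℝ) (T : 𝔼 → 𝔼 → ℝ) : ℝ :=
  ∑ j, ∑ k, A⁻¹ j k * T (stdVec j) (stdVec k)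

lemma contraction_eq_trace (A T : Matrix (Fin n) (Fin n) ℝ) :
    ∑ j, ∑ k, A⁻¹ j k * T j k = (A⁻¹ * T.transpose).trace := by
  simp [Matrix.trace, Matrix.mul_apply]

/-- Pullback of a bilinear form is congruence `PᵀT'P` by the matrix `P` of `L`. -/
lemma matrix_of_transform {T : 𝔼 → 𝔼 → ℝ} {T' : 𝔼 →L[ℝ] 𝔼 →L[ℝ] ℝ} {L : 𝔼 →L[ℝ] 𝔼}
    (h : ∀ v w, T v w = T' (L v) (L w)) :
    (Matrix.of fun i j => T (stdVec i) (stdVec j)) =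
      (Matrix.of fun a i => L (stdVec i) a).transpose *
        (Matrix.of fun i j => T' (stdVec i) (stdVec j)) *
          (Matrix.of fun a i => L (stdVec i) a) := by
  ext i j
  simp only [Matrix.of_apply, h, Matrix.mul_apply, Matrix.transpose_apply]
  conv_lhs => rw [← sum_smul_stdVec (L (stdVec i)), ← sum_smul_stdVec (L (stdVec j))]
  simp only [map_sum, map_smul, _root_.sum_apply, smul_eq_mul, _root_.smul_apply]
  simp only [Finset.sum_mul, Finset.mul_sum]
  refine Finset.sum_congr rfl fun a _ => Finset.sum_congr rfl fun b _ => by ring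

/-- Full contractions do not depend on the coordinates. -/
lemma contraction_transform {A A' : Matrix (Fin n) (Fin n) ℝ} {T : 𝔼 → 𝔼 → ℝ}
    {T' : 𝔼 →L[ℝ] 𝔼 →L[ℝ] ℝ} {L : 𝔼 →L[ℝ] 𝔼}
    (hA : ∀ v w, bilinForm A v w = bilinForm A' (L v) (L w))
    (hT : ∀ v w, T v w = T' (L v) (L w)) (hdet : A.det ≠ 0) :
    contraction A T = contraction A' (fun v w => T' v w) := by
  have h1 := matrix_of_transform hA
  have h2 := matrix_of_transform hT
  set P : Matrix (Fin n) (Fin n) ℝ := Matrix.of fun a i => L (stdVec i) a with hP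
  have e1 : (Matrix.of fun i j => bilinForm A (stdVec i) (stdVec j)) = A := by ext; simp
  have e2 : (Matrix.of fun i j => bilinForm A' (stdVec i) (stdVec j)) = A' := by ext; simp
  rw [e1, e2] at h1
  have hPd : IsUnit P.det := by
    rw [isUnit_iff_ne_zero]
    rintro h0
    apply hdet
    rw [h1, Matrix.det_mul, h0, mul_zero]
  have hPd' : IsUnit P.transpose.det := by rwa [Matrix.det_transpose]
  have k1 := contraction_eq_trace A (Matrix.of fun i j => T (stdVec i) (stdVec j))
  have k2 := contraction_eq_trace A' (Matrix.of fun i j => T' (stdVec i) (stdVec j))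
  simp only [Matrix.of_apply] at k1 k2
  -- With `A = PᵀA'P` and `T = PᵀT'P`, the matrix `A⁻¹Tᵀ` equals `P⁻¹ (A'⁻¹ T'ᵀ) P`; cyclicity of
  -- the trace removes `P`.
  rw [contraction, contraction, k1, k2, h2, h1]
  set S := (Matrix.of fun i j => T' (stdVec i) (stdVec j))
  rw [Matrix.mul_inv_rev, Matrix.mul_inv_rev, Matrix.transpose_mul, Matrix.transpose_mul,
    Matrix.transpose_transpose]
  rw [Matrix.trace_mul_comm]
  simp only [Matrix.mul_assoc]
  rw [Matrix.mul_nonsing_inv_cancel_left _ _ hPd, Matrix.trace_mul_comm]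
  simp only [Matrix.mul_assoc]
  rw [Matrix.trace_mul_comm]
  simp only [Matrix.mul_assoc]
  rw [Matrix.nonsing_inv_mul_cancel_left _ _ hPd']

/-- Determinants of the congruence `A = PᵀA'P`. It serves twice: for the invertibility of the
differential of an isometry, and for the change of variables in the volume. -/
lemma det_transform {A A' : Matrix (Fin n) (Fin n) ℝ} {L : 𝔼 →L[ℝ] 𝔼}
    (hA : ∀ v w, bilinForm A v w = bilinForm A' (L v) (L w)) :
    A.det = L.det ^ 2 * A'.det := by
  have h1 := matrix_of_transform hA
  have e1 : (Matrix.of fun i j => bilinForm A (stdVec i) (stdVec j)) = A := by ext; simp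
  have e2 : (Matrix.of fun i j => bilinForm A' (stdVec i) (stdVec j)) = A' := by ext; simp
  rw [e1, e2] at h1
  have : (Matrix.of fun a i => L (stdVec i) a) =
      LinearMap.toMatrix (EuclideanSpace.basisFun (Fin n) ℝ).toBasis
        (EuclideanSpace.basisFun (Fin n) ℝ).toBasis (L : 𝔼 →ₗ[ℝ] 𝔼) := by
    ext a i
    simp [LinearMap.toMatrix_apply]
  rw [h1, Matrix.det_mul, Matrix.det_mul, Matrix.det_transpose, this, LinearMap.det_toMatrix]
  simp only [ContinuousLinearMap.det]
  ring

end Coordinates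

/-! ### The Levi-Civita connection of a metric on an open set of ℝⁿ -/

section LocalGeometry

lemma contDiffAt_smul_const {F : Type*} [NormedAddCommGroup F] [NormedSpace ℝ F] {k : ℕ∞ω}
    {f : 𝔼 → ℝ} {y : 𝔼} (hf : ContDiffAt ℝ k f y) (c : F) : ContDiffAt ℝ k (fun z => f z • c) y :=
  hf.smul contDiffAt_const

lemma contDiffAt_bilinForm {k : ℕ∞ω} {G : 𝔼 → Matrix (Fin n) (Fin n) ℝ} {y : 𝔼}
    (hG : ∀ i j, ContDiffAt ℝ k (fun z => G z i j) y) :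
    ContDiffAt ℝ k (fun z => bilinForm (G z)) y := by
  unfold bilinForm
  exact ContDiffAt.sum fun i _ => ContDiffAt.sum fun j _ => contDiffAt_smul_const (hG i j) _

lemma contDiffAt_bilinMap {k : ℕ∞ω} {Γ : 𝔼 → Fin n → Fin n → Fin n → ℝ} {y : 𝔼}
    (hΓ : ∀ i j l, ContDiffAt ℝ k (fun z => Γ z i j l) y) :
    ContDiffAt ℝ k (fun z => bilinMap (Γ z)) y := by
  unfold bilinMap
  exact ContDiffAt.sum fun i _ => ContDiffAt.sum fun j _ => ContDiffAt.sum fun l _ =>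
    contDiffAt_smul_const (hΓ i j l) _

lemma contDiffAt_det {m : Type*} [Fintype m] [DecidableEq m] {k : ℕ∞ω} {G : 𝔼 → Matrix m m ℝ}
    {y : 𝔼} (hG : ∀ i j, ContDiffAt ℝ k (fun z => G z i j) y) :
    ContDiffAt ℝ k (fun z => (G z).det) y := by
  simp only [Matrix.det_apply]
  exact ContDiffAt.sum fun σ _ => (contDiffAt_prod fun i _ => hG _ _).const_smul _

/-- Cramer's rule: an entry of the inverse is a cofactor divided by the determinant. -/
lemma contDiffAt_inv {k : ℕ∞ω} {G : 𝔼 → Matrix (Fin n) (Fin n) ℝ} {y : 𝔼}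
    (hG : ∀ i j, ContDiffAt ℝ k (fun z => G z i j) y) (hdet : (G y).det ≠ 0) (i j : Fin n) :
    ContDiffAt ℝ k (fun z => (G z)⁻¹ i j) y := by
  simp only [Matrix.inv_def, Matrix.smul_apply, Ring.inverse_eq_inv', smul_eq_mul,
    Matrix.adjugate_apply]
  refine ((contDiffAt_det hG).inv hdet).mul (contDiffAt_det fun a b => ?_)
  by_cases h : a = j
  · subst h; simpa using contDiffAt_const
  · simpa [Matrix.updateRow_ne h] using hG a b

lemma contDiffAt_partialDeriv {f : 𝔼 → ℝ} {y : 𝔼} (hf : ContDiffAt ℝ ∞ f y) (i : Fin n) :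
    ContDiffAt ℝ ∞ (fun z => partialDeriv i f z) y :=
  (hf.fderiv_right (m := ∞) le_rfl).clm_apply contDiffAt_const

lemma fderiv_apply_eq_sum (f : 𝔼 → ℝ) (y v : 𝔼) :
    fderiv ℝ f y v = ∑ i, v i * partialDeriv i f y := by
  conv_lhs => rw [← sum_smul_stdVec v]
  simp [partialDeriv, stdVec]

lemma partialDeriv_partialDeriv {f : 𝔼 → ℝ} {y : 𝔼} (hf : ContDiffAt ℝ 2 f y) (i j : Fin n) :
    partialDeriv i (fun z => partialDeriv j f z) y =
      fderiv ℝ (fderiv ℝ f) y (stdVec i) (stdVec j) := by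
  have hdf : DifferentiableAt ℝ (fderiv ℝ f) y :=
    (hf.fderiv_right (m := 1) (by norm_num)).differentiableAt (by norm_num)
  unfold partialDeriv
  rw [(hdf.hasFDerivAt.clm_apply (hasFDerivAt_const (EuclideanSpace.single j (1 : ℝ)) y)).fderiv]
  simp [stdVec]

/-- The Christoffel symbols `Γ^k_{ij}` of the metric on `ℝⁿ` with coefficients `G`. -/
def localChristoffel (G : 𝔼 → Matrix (Fin n) (Fin n) ℝ) (y : 𝔼) (i j k : Fin n) : ℝ :=
  (1 / 2 : ℝ) * ∑ l, (G y)⁻¹ k l *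
    (partialDeriv i (fun z => G z j l) y + partialDeriv j (fun z => G z i l) y
      - partialDeriv l (fun z => G z i j) y)

/-- The Levi-Civita connection of the metric on `ℝⁿ` with coefficients `G`. -/
def leviCivita (G : 𝔼 → Matrix (Fin n) (Fin n) ℝ) (y : 𝔼) : 𝔼 →L[ℝ] 𝔼 →L[ℝ] 𝔼 :=
  bilinMap (localChristoffel G y)

lemma contDiffAt_localChristoffel {G : 𝔼 → Matrix (Fin n) (Fin n) ℝ} {y : 𝔼}
    (hG : ∀ i j, ContDiffAt ℝ ∞ (fun z => G z i j) y) (hdet : (G y).det ≠ 0) (i j k : Fin n) :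
    ContDiffAt ℝ ∞ (fun z => localChristoffel G z i j k) y := by
  unfold localChristoffel
  refine contDiffAt_const.mul (ContDiffAt.sum fun l _ => (contDiffAt_inv hG hdet k l).mul ?_)
  exact ((contDiffAt_partialDeriv (hG _ _) _).add (contDiffAt_partialDeriv (hG _ _) _)).sub
    (contDiffAt_partialDeriv (hG _ _) _)

lemma contDiffAt_leviCivita {G : 𝔼 → Matrix (Fin n) (Fin n) ℝ} {y : 𝔼}
    (hG : ∀ i j, ContDiffAt ℝ ∞ (fun z => G z i j) y) (hdet : (G y).det ≠ 0) :
    ContDiffAt ℝ ∞ (leviCivita G) y :=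
  contDiffAt_bilinMap (contDiffAt_localChristoffel hG hdet)

/-- Symmetry of `G` is assumed at every `z` because the coefficients are differentiated, so they
must agree as functions. -/
lemma localChristoffel_symm {G : 𝔼 → Matrix (Fin n) (Fin n) ℝ} (hs : ∀ z, (G z).IsSymm)
    (y : 𝔼) (i j k : Fin n) : localChristoffel G y i j k = localChristoffel G y j i k := by
  unfold localChristoffel
  congr 1
  refine Finset.sum_congr rfl fun l _ => ?_
  have : (fun z => G z i j) = fun z => G z j i := funext fun z => (hs z).apply j i
  rw [this, add_comm (partialDeriv i _ _)]

lemma leviCivita_symm {G : 𝔼 → Matrix (Fin n) (Fin n) ℝ} (hs : ∀ z, (G z).IsSymm)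
    (y v w : 𝔼) : leviCivita G y v w = leviCivita G y w v := by
  have : leviCivita G y = (leviCivita G y).flip :=
    clm_ext₂ fun i j => by
      ext k
      simp only [leviCivita, ContinuousLinearMap.flip_apply, bilinMap_stdVec]
      exact localChristoffel_symm hs y i j k
  conv_lhs => rw [this]
  rfl

lemma partialDeriv_coeff {G : 𝔼 → Matrix (Fin n) (Fin n) ℝ} {y : 𝔼}
    (hG : ∀ i j, ContDiffAt ℝ ∞ (fun z => G z i j) y) (i j k : Fin n) :
    partialDeriv i (fun z => G z j k) y =
      fderiv ℝ (fun z => bilinForm (G z)) y (stdVec i) (stdVec j) (stdVec k) := by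
  have hd : DifferentiableAt ℝ (fun z => bilinForm (G z)) y :=
    (contDiffAt_bilinForm hG).differentiableAt (by simp)
  rw [← fderiv_apply₂ hd]
  simp [partialDeriv, stdVec]

lemma bilinForm_symm {A : Matrix (Fin n) (Fin n) ℝ} (hs : A.IsSymm) (v w : 𝔼) :
    bilinForm A v w = bilinForm A w v := by
  have : bilinForm A = (bilinForm A).flip :=
    clm_ext₂ fun i j => by simpa using (hs.apply j i)
  conv_lhs => rw [this]
  rfl

/-- On coordinate vectors, lowering the index of the Christoffel symbols cancels the inverse metric;
trilinearity extends this to all vectors. Together with nondegeneracy the formula characterises the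
connection without indices, which is what makes the change of coordinates tractable. -/
theorem koszul_leviCivita {G : 𝔼 → Matrix (Fin n) (Fin n) ℝ} {y : 𝔼}
    (hG : ∀ i j, ContDiffAt ℝ ∞ (fun z => G z i j) y) (hs : (G y).IsSymm)
    (hdet : (G y).det ≠ 0) (u v w : 𝔼) :
    2 * bilinForm (G y) (leviCivita G y u v) w =
      fderiv ℝ (fun z => bilinForm (G z)) y u v w + fderiv ℝ (fun z => bilinForm (G z)) y v u w
        - fderiv ℝ (fun z => bilinForm (G z)) y w u v := by
  set D := fderiv ℝ (fun z => bilinForm (G z)) y with hD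
  have hbase : ∀ i j l, 2 * bilinForm (G y) (leviCivita G y (stdVec i) (stdVec j)) (stdVec l) =
      D (stdVec i) (stdVec j) (stdVec l) + D (stdVec j) (stdVec i) (stdVec l)
        - D (stdVec l) (stdVec i) (stdVec j) := by
    intro i j l
    have h1 : bilinForm (G y) (leviCivita G y (stdVec i) (stdVec j)) (stdVec l) =
        ∑ k, localChristoffel G y i j k * G y k l := by
      rw [← sum_smul_stdVec (leviCivita G y (stdVec i) (stdVec j))]
      simp [leviCivita, _root_.sum_apply]
    rw [h1]
    simp only [localChristoffel]
    have h2 : ∀ m, ∑ k, (G y)⁻¹ k m * G y k l = if l = m then 1 else 0 := by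
      intro m
      have := congr_fun (congr_fun (Matrix.mul_nonsing_inv (G y) (isUnit_iff_ne_zero.2 hdet)) l) m
      rw [Matrix.mul_apply, Matrix.one_apply] at this
      rw [← this]
      exact Finset.sum_congr rfl fun k _ => by rw [hs.apply k l, mul_comm]
    simp only [partialDeriv_coeff hG, ← hD]
    set X : Fin n → ℝ := fun m => D (stdVec i) (stdVec j) (stdVec m)
      + D (stdVec j) (stdVec i) (stdVec m) - D (stdVec m) (stdVec i) (stdVec j) with hX
    calc 2 * ∑ k, (1 / 2 : ℝ) * (∑ m, (G y)⁻¹ k m * X m) * G y k l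
        = ∑ k, ∑ m, X m * ((G y)⁻¹ k m * G y k l) := by
          rw [Finset.mul_sum]
          refine Finset.sum_congr rfl fun k _ => ?_
          rw [Finset.mul_sum, Finset.sum_mul, Finset.mul_sum]
          exact Finset.sum_congr rfl fun m _ => by ring
      _ = X l := by
          rw [Finset.sum_comm]
          simp [← Finset.mul_sum, h2]
  induction u using vec_induction with
  | hzero => simp
  | hadd a b ha hb => simp only [map_add, _root_.add_apply]; linarith
  | hsmul c a ha =>
    simp only [map_smul, _root_.smul_apply, smul_eq_mul]; linear_combination c * ha
  | hstd i =>
  induction v using vec_induction with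
  | hzero => simp
  | hadd a b ha hb => simp only [map_add, _root_.add_apply]; linarith
  | hsmul c a ha =>
    simp only [map_smul, _root_.smul_apply, smul_eq_mul]; linear_combination c * ha
  | hstd j =>
  induction w using vec_induction with
  | hzero => simp
  | hadd a b ha hb => simp only [map_add, _root_.add_apply]; linarith
  | hsmul c a ha =>
    simp only [map_smul, _root_.smul_apply, smul_eq_mul]; linear_combination c * ha
  | hstd l => exact hbase i j l

end LocalGeometry

/-! ### Isometry invariance of scalar curvature, gradient norm and Laplacian -/

section Invariance

lemma natCast_le_infty (m : ℕ) : (m : ℕ∞ω) ≤ ∞ := mod_cast le_top (a := (m : ℕ∞))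

/-- `G` gives the coefficients of a smooth Riemannian metric on the open set `U ⊆ ℝⁿ`. -/
structure IsMetricOn (G : EuclideanSpace ℝ (Fin n) → Matrix (Fin n) (Fin n) ℝ)
    (U : Set (EuclideanSpace ℝ (Fin n))) : Prop where
  isOpen : IsOpen U
  contDiffAt : ∀ y ∈ U, ∀ i j, ContDiffAt ℝ ∞ (fun z => G z i j) y
  symm : ∀ z, (G z).IsSymm
  posDef : ∀ y ∈ U, (G y).PosDef

lemma IsMetricOn.det_ne_zero {G : 𝔼 → Matrix (Fin n) (Fin n) ℝ} {U : Set 𝔼}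
    (hG : IsMetricOn G U) {y : 𝔼} (hy : y ∈ U) : (G y).det ≠ 0 :=
  (hG.posDef y hy).det_pos.ne'

lemma IsMetricOn.differentiableAt_leviCivita {G : 𝔼 → Matrix (Fin n) (Fin n) ℝ} {U : Set 𝔼}
    (hG : IsMetricOn G U) {y : 𝔼} (hy : y ∈ U) : DifferentiableAt ℝ (leviCivita G) y :=
  (contDiffAt_leviCivita (hG.contDiffAt y hy) (hG.det_ne_zero hy)).differentiableAt (by simp)

/-- `ψ` is an isometry of the open set `U` with metric `G` into `ℝⁿ` with metric `G'`. -/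
structure IsIsometryOn (G G' : EuclideanSpace ℝ (Fin n) → Matrix (Fin n) (Fin n) ℝ)
    (U U' : Set (EuclideanSpace ℝ (Fin n)))
    (ψ : EuclideanSpace ℝ (Fin n) → EuclideanSpace ℝ (Fin n)) : Prop where
  mapsTo : Set.MapsTo ψ U U'
  contDiffAt : ∀ y ∈ U, ContDiffAt ℝ ∞ ψ y
  metric : ∀ y ∈ U, ∀ v w, bilinForm (G y) v w =
    bilinForm (G' (ψ y)) (fderiv ℝ ψ y v) (fderiv ℝ ψ y w)

variable {G G' : EuclideanSpace ℝ (Fin n) → Matrix (Fin n) (Fin n) ℝ}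
  {U U' : Set (EuclideanSpace ℝ (Fin n))}
  {ψ : EuclideanSpace ℝ (Fin n) → EuclideanSpace ℝ (Fin n)}

/-- Since `det G = (det dψ)² det G'` is nonzero, so is `det dψ`. -/
lemma IsIsometryOn.bijective (hG : IsMetricOn G U) (hψ : IsIsometryOn G G' U U' ψ) {y : 𝔼}
    (hy : y ∈ U) : Function.Bijective (fderiv ℝ ψ y) := by
  have h : LinearMap.det (fderiv ℝ ψ y : 𝔼 →ₗ[ℝ] 𝔼) ≠ 0 := by
    intro h0
    apply hG.det_ne_zero hy
    rw [det_transform (hψ.metric y hy), ContinuousLinearMap.det, h0]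
    ring
  exact (LinearMap.equivOfDetNeZero _ h).bijective

theorem IsIsometryOn.leviCivita (hG : IsMetricOn G U) (hG' : IsMetricOn G' U')
    (hψ : IsIsometryOn G G' U U' ψ) {y : 𝔼} (hy : y ∈ U) (u v : 𝔼) :
    fderiv ℝ ψ y (leviCivita G y u v) = fderiv ℝ (fderiv ℝ ψ) y u v
      + WeightedScalar.leviCivita G' (ψ y) (fderiv ℝ ψ y u) (fderiv ℝ ψ y v) := by
  have hy' := hψ.mapsTo hy
  refine koszul_transform (B := fun z => bilinForm (G z)) (B' := fun z => bilinForm (G' z))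
    ((hψ.contDiffAt y hy).of_le (natCast_le_infty 2))
    ((contDiffAt_bilinForm (hG.contDiffAt y hy)).differentiableAt (by simp))
    ((contDiffAt_bilinForm (hG'.contDiffAt _ hy')).differentiableAt (by simp))
    (Filter.eventually_of_mem (hG.isOpen.mem_nhds hy) hψ.metric)
    (bilinForm_symm (hG'.symm _))
    (koszul_leviCivita (hG.contDiffAt y hy) (hG.symm y) (hG.det_ne_zero hy))
    (koszul_leviCivita (hG'.contDiffAt _ hy') (hG'.symm _) (hG'.det_ne_zero hy'))
    (fun v hv => ?_) u v
  -- Nondegeneracy: write the vector as `dψ w`. Then `G(w, w) = G'(dψ w, dψ w) = 0`, and positivity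
  -- of `G` forces `w = 0`.
  obtain ⟨w, rfl⟩ := (hψ.bijective hG hy).2 v
  have h := hψ.metric y hy w w
  by_contra hne
  have hw : w ≠ 0 := by rintro rfl; simp at hne
  have hpos := (hG.posDef y hy).dotProduct_mulVec_pos (x := w) (fun h => hw (by ext i; simp [h]))
  have : bilinForm (G y) w w = 0 := by rw [h, hv w]
  rw [star_dotProduct_mulVec] at hpos
  exact hpos.ne' this

/-- The connection law holds on all of the open set `U`, so it may be differentiated at `y`. -/
theorem IsIsometryOn.curvatureAt (hG : IsMetricOn G U) (hG' : IsMetricOn G' U')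
    (hψ : IsIsometryOn G G' U U' ψ) {y : 𝔼} (hy : y ∈ U) (x v w : 𝔼) :
    fderiv ℝ ψ y (curvatureAt (WeightedScalar.leviCivita G) y x v w) =
      WeightedScalar.curvatureAt (WeightedScalar.leviCivita G') (ψ y) (fderiv ℝ ψ y x)
        (fderiv ℝ ψ y v) (fderiv ℝ ψ y w) :=
  curvatureAt_transform ((hψ.contDiffAt y hy).of_le (natCast_le_infty 3))
    (hG.differentiableAt_leviCivita hy) (hG'.differentiableAt_leviCivita (hψ.mapsTo hy))
    (Filter.eventually_of_mem (hG.isOpen.mem_nhds hy) fun _ hz => hψ.leviCivita hG hG' hz) x v w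

/-- The Ricci form `Ric(v, w) = tr (x ↦ R(x, v) w)` of a connection. -/
def ricciForm (C : 𝔼 → 𝔼 →L[ℝ] 𝔼 →L[ℝ] 𝔼) (y : 𝔼) : 𝔼 →L[ℝ] 𝔼 →L[ℝ] ℝ :=
  bilinForm (Matrix.of fun j k => ∑ i, curvatureAt C y (stdVec i) (stdVec j) (stdVec k) i)

/-- The form is bundled from its values on coordinate vectors; linearity of the curvature in `v` and
`w` recovers the trace formula for arbitrary vectors. -/
lemma ricciForm_apply (C : 𝔼 → 𝔼 →L[ℝ] 𝔼 →L[ℝ] 𝔼) (y v w : 𝔼) :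
    ricciForm C y v w = ∑ i, curvatureAt C y (stdVec i) v w i := by
  have key : ∀ x,
      (∀ a b c, curvatureAt C y x (a + b) c = curvatureAt C y x a c + curvatureAt C y x b c)
      ∧ (∀ a b c, curvatureAt C y x a (b + c) = curvatureAt C y x a b + curvatureAt C y x a c)
      ∧ (∀ (r : ℝ) a b, curvatureAt C y x (r • a) b = r • curvatureAt C y x a b)
      ∧ (∀ (r : ℝ) a b, curvatureAt C y x a (r • b) = r • curvatureAt C y x a b)
      ∧ (∀ a, curvatureAt C y x 0 a = 0) ∧ (∀ a, curvatureAt C y x a 0 = 0) := by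
    intro x
    refine ⟨?_, ?_, ?_, ?_, ?_, ?_⟩ <;> intros <;> simp [curvatureAt] <;> module
  choose h1 h2 h3 h4 h5 h6 using key
  induction v using vec_induction with
  | hzero => simp [h5]
  | hadd a b ha hb => simp [h1, Finset.sum_add_distrib, ha, hb]
  | hsmul c a ha => simp [h3, ← Finset.mul_sum, ha]
  | hstd j =>
  induction w using vec_induction with
  | hzero => simp [h6]
  | hadd a b ha hb => simp [h2, Finset.sum_add_distrib, ha, hb]
  | hsmul c a ha => simp [h4, ← Finset.mul_sum, ha]
  | hstd k => simp [ricciForm]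

/-- Both sums are traces, and `L` conjugates one endomorphism into the other. -/
lemma sum_diag_eq_of_conj {R R' L : 𝔼 →ₗ[ℝ] 𝔼} (h : ∀ x, L (R x) = R' (L x))
    (hL : Function.Bijective L) : ∑ i, R (stdVec i) i = ∑ i, R' (stdVec i) i := by
  have htr : ∀ S : 𝔼 →ₗ[ℝ] 𝔼, ∑ i, S (stdVec i) i = LinearMap.trace ℝ 𝔼 S := by
    intro S
    rw [LinearMap.trace_eq_matrix_trace ℝ (EuclideanSpace.basisFun (Fin n) ℝ).toBasis]
    simp [Matrix.trace, LinearMap.toMatrix_apply]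
  have : (LinearEquiv.ofBijective L hL).conj R = R' := by
    ext1 x
    obtain ⟨z, rfl⟩ := hL.2 x
    have h2 : (LinearEquiv.ofBijective L hL).symm (L z) = z :=
      (LinearEquiv.ofBijective L hL).symm_apply_apply z
    rw [LinearEquiv.conj_apply_apply, h2]
    exact h z
  rw [htr, htr, ← this, LinearMap.trace_conj']

/-- By naturality of the curvature, `dψ` conjugates `x ↦ R(x, v)w` into `x ↦ R'(x, dψ v)(dψ w)`. -/
theorem IsIsometryOn.ricciForm (hG : IsMetricOn G U) (hG' : IsMetricOn G' U')
    (hψ : IsIsometryOn G G' U U' ψ) {y : 𝔼} (hy : y ∈ U) (v w : 𝔼) :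
    ricciForm (WeightedScalar.leviCivita G) y v w =
      WeightedScalar.ricciForm (WeightedScalar.leviCivita G') (ψ y)
        (fderiv ℝ ψ y v) (fderiv ℝ ψ y w) := by
  rw [ricciForm_apply, ricciForm_apply]
  let lin : ∀ (C : 𝔼 → 𝔼 →L[ℝ] 𝔼 →L[ℝ] 𝔼) (y v w : 𝔼), 𝔼 →ₗ[ℝ] 𝔼 := fun C y v w =>
    { toFun := fun x => WeightedScalar.curvatureAt C y x v w
      map_add' := fun a b => by simp [WeightedScalar.curvatureAt]; module
      map_smul' := fun r a => by simp [WeightedScalar.curvatureAt]; module }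
  exact sum_diag_eq_of_conj (R := lin (WeightedScalar.leviCivita G) y v w)
    (R' := lin (WeightedScalar.leviCivita G') (ψ y) (fderiv ℝ ψ y v) (fderiv ℝ ψ y w))
    (L := fderiv ℝ ψ y) (fun x => hψ.curvatureAt hG hG' hy x v w) (hψ.bijective hG hy)

/-- The Hessian of `f` for the metric `G`. -/
def hessianForm (G : 𝔼 → Matrix (Fin n) (Fin n) ℝ) (f : 𝔼 → ℝ) (y : 𝔼) : 𝔼 →L[ℝ] 𝔼 →L[ℝ] ℝ :=
  fderiv ℝ (fderiv ℝ f) y -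
    (ContinuousLinearMap.compL ℝ 𝔼 𝔼 ℝ (fderiv ℝ f y)).comp (leviCivita G y)

@[simp] lemma hessianForm_apply (G : 𝔼 → Matrix (Fin n) (Fin n) ℝ) (f : 𝔼 → ℝ) (y v w : 𝔼) :
    hessianForm G f y v w =
      fderiv ℝ (fderiv ℝ f) y v w - fderiv ℝ f y (leviCivita G y v w) := rfl

/-- The form `df ⊗ df`. -/
def gradForm (f : 𝔼 → ℝ) (y : 𝔼) : 𝔼 →L[ℝ] 𝔼 →L[ℝ] ℝ :=
  (fderiv ℝ f y).smulRight (fderiv ℝ f y)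

@[simp] lemma gradForm_apply (f : 𝔼 → ℝ) (y v w : 𝔼) :
    gradForm f y v w = fderiv ℝ f y v * fderiv ℝ f y w := rfl

/-- The scalar curvature of the metric `G`. -/
def localScalar (G : 𝔼 → Matrix (Fin n) (Fin n) ℝ) (y : 𝔼) : ℝ :=
  contraction (G y) fun v w => ricciForm (leviCivita G) y v w

/-- The Laplacian of `f` for the metric `G`. -/
def localLaplacian (G : 𝔼 → Matrix (Fin n) (Fin n) ℝ) (f : 𝔼 → ℝ) (y : 𝔼) : ℝ :=
  contraction (G y) fun v w => hessianForm G f y v w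

/-- The squared norm of the gradient of `f` for the metric `G`. -/
def localGradNormSq (G : 𝔼 → Matrix (Fin n) (Fin n) ℝ) (f : 𝔼 → ℝ) (y : 𝔼) : ℝ :=
  contraction (G y) fun v w => gradForm f y v w

theorem IsIsometryOn.localScalar (hG : IsMetricOn G U) (hG' : IsMetricOn G' U')
    (hψ : IsIsometryOn G G' U U' ψ) {y : 𝔼} (hy : y ∈ U) :
    localScalar G y = WeightedScalar.localScalar G' (ψ y) :=
  contraction_transform (hψ.metric y hy) (hψ.ricciForm hG hG' hy) (hG.det_ne_zero hy)

lemma fderiv_comp_of_eventuallyEq {f f' : 𝔼 → ℝ} {y : 𝔼} (hψ : DifferentiableAt ℝ ψ y)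
    (hf' : DifferentiableAt ℝ f' (ψ y)) (h : f =ᶠ[𝓝 y] fun z => f' (ψ z)) (v : 𝔼) :
    fderiv ℝ f y v = fderiv ℝ f' (ψ y) (fderiv ℝ ψ y v) := by
  rw [h.fderiv_eq]
  exact congrArg (· v) (fderiv_comp y hf' hψ)

theorem IsIsometryOn.localGradNormSq (hG : IsMetricOn G U)
    (hψ : IsIsometryOn G G' U U' ψ) {f f' : 𝔼 → ℝ} (hf' : ∀ y ∈ U', ContDiffAt ℝ ∞ f' y)
    (hf : ∀ y ∈ U, f y = f' (ψ y)) {y : 𝔼} (hy : y ∈ U) :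
    localGradNormSq G f y = WeightedScalar.localGradNormSq G' f' (ψ y) := by
  have he : f =ᶠ[𝓝 y] fun z => f' (ψ z) := Filter.eventually_of_mem (hG.isOpen.mem_nhds hy) hf
  refine contraction_transform (hψ.metric y hy) (fun v w => ?_) (hG.det_ne_zero hy)
  simp only [gradForm_apply]
  rw [fderiv_comp_of_eventuallyEq ((hψ.contDiffAt y hy).differentiableAt (by simp))
    ((hf' _ (hψ.mapsTo hy)).differentiableAt (by simp)) he,
    fderiv_comp_of_eventuallyEq ((hψ.contDiffAt y hy).differentiableAt (by simp))
    ((hf' _ (hψ.mapsTo hy)).differentiableAt (by simp)) he]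

/-- The Hessian is tensorial: the term `df'(D²ψ(v, w))` from differentiating `f' ∘ ψ` twice cancels
the one from the transformation law of the connection. -/
theorem IsIsometryOn.localLaplacian (hG : IsMetricOn G U) (hG' : IsMetricOn G' U')
    (hψ : IsIsometryOn G G' U U' ψ) {f f' : 𝔼 → ℝ} (hf' : ∀ y ∈ U', ContDiffAt ℝ ∞ f' y)
    (hf : ∀ y ∈ U, f y = f' (ψ y)) {y : 𝔼} (hy : y ∈ U) :
    localLaplacian G f y = WeightedScalar.localLaplacian G' f' (ψ y) := by
  have hfd : ∀ z ∈ U, ∀ v, fderiv ℝ f z v = fderiv ℝ f' (ψ z) (fderiv ℝ ψ z v) := fun z hz v =>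
    fderiv_comp_of_eventuallyEq ((hψ.contDiffAt z hz).differentiableAt (by simp))
      ((hf' _ (hψ.mapsTo hz)).differentiableAt (by simp))
      (Filter.eventually_of_mem (hG.isOpen.mem_nhds hz) hf) v
  refine contraction_transform (hψ.metric y hy) (fun v w => ?_) (hG.det_ne_zero hy)
  simp only [hessianForm_apply]
  rw [hfd y hy, hψ.leviCivita hG hG' hy, map_add]
  have hψd : DifferentiableAt ℝ (fderiv ℝ ψ) y :=
    ((hψ.contDiffAt y hy).fderiv_right (m := 1) (natCast_le_infty 2)).differentiableAt (by norm_num)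
  have hfd' : DifferentiableAt ℝ (fderiv ℝ f') (ψ y) :=
    ((hf' _ (hψ.mapsTo hy)).fderiv_right (m := 1) (natCast_le_infty 2)).differentiableAt
      (by norm_num)
  have hfs : ContDiffAt ℝ ∞ f y := by
    have : ContDiffAt ℝ ∞ (f' ∘ ψ) y := (hf' _ (hψ.mapsTo hy)).comp y (hψ.contDiffAt y hy)
    exact this.congr_of_eventuallyEq (Filter.eventually_of_mem (hG.isOpen.mem_nhds hy) hf)
  have hffd : DifferentiableAt ℝ (fderiv ℝ f) y :=
    (hfs.fderiv_right (m := 1) (natCast_le_infty 2)).differentiableAt (by norm_num)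
  have h1 : HasFDerivAt (fun z => fderiv ℝ f' (ψ z))
      ((fderiv ℝ (fderiv ℝ f') (ψ y)).comp (fderiv ℝ ψ y)) y :=
    HasFDerivAt.comp (g := fderiv ℝ f') (f := ψ) y hfd'.hasFDerivAt
      ((hψ.contDiffAt y hy).differentiableAt (by simp)).hasFDerivAt
  have h2 := h1.clm_apply (hψd.hasFDerivAt.clm_apply (hasFDerivAt_const w y))
  have h3 := hffd.hasFDerivAt.clm_apply (hasFDerivAt_const w y)
  have h4 := h2.congr_of_eventuallyEq
    (Filter.eventually_of_mem (hG.isOpen.mem_nhds hy) fun z hz => hfd z hz w)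
  have h5 := DFunLike.congr_fun (h3.unique h4) v
  simp at h5
  rw [h5]
  ring

end Invariance

/-! ### Pointwise formulas for the contracted curvatures -/

section ScalarIdentities

/-- The bridge from the index definition of curvature to the invariant one used in the
transformation laws. -/
lemma connCurvature_eq {Γ : 𝔼 → Fin n → Fin n → Fin n → ℝ} {y : 𝔼}
    (hΓ : ∀ i j k, ContDiffAt ℝ ∞ (fun z => Γ z i j k) y) (i j k m : Fin n) :
    connCurvature Γ y i j k m =
      curvatureAt (fun z => bilinMap (Γ z)) y (stdVec i) (stdVec j) (stdVec k) m := by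
  have hd : DifferentiableAt ℝ (fun z => bilinMap (Γ z)) y :=
    (contDiffAt_bilinMap hΓ).differentiableAt (by simp)
  have hD : ∀ i j k m, partialDeriv i (fun z => Γ z j k m) y =
      fderiv ℝ (fun z => bilinMap (Γ z)) y (stdVec i) (stdVec j) (stdVec k) m := by
    intro i j k m
    have hd2 := (hd.hasFDerivAt.clm_apply (hasFDerivAt_const (stdVec j) y)).clm_apply
      (hasFDerivAt_const (stdVec k) y)
    have h3 := (EuclideanSpace.proj m : 𝔼 →L[ℝ] ℝ).hasFDerivAt.comp y hd2
    have h4 : (fun z => Γ z j k m) = (EuclideanSpace.proj m : 𝔼 →L[ℝ] ℝ) ∘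
        fun z => bilinMap (Γ z) (stdVec j) (stdVec k) := by
      ext z
      simp
    rw [partialDeriv, h4, h3.fderiv]
    simp [stdVec]
  have hC : ∀ i j k m, bilinMap (Γ y) (stdVec i) (bilinMap (Γ y) (stdVec j) (stdVec k)) m =
      ∑ p, Γ y j k p * Γ y i p m := by
    intro i j k m
    conv_lhs => rw [← sum_smul_stdVec (bilinMap (Γ y) (stdVec j) (stdVec k))]
    simp
  simp only [connCurvature, curvatureAt, hD, Finset.sum_sub_distrib, PiLp.add_apply,
    PiLp.sub_apply, hC]
  ring

lemma inv_symm {A : Matrix (Fin n) (Fin n) ℝ} (hs : A.IsSymm) (i j : Fin n) :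
    A⁻¹ i j = A⁻¹ j i := by
  have : A⁻¹.transpose = A⁻¹ := by rw [Matrix.transpose_nonsing_inv, hs.eq]
  exact congr_fun (congr_fun this j) i

lemma sum_inv_mul {A : Matrix (Fin n) (Fin n) ℝ} (hdet : A.det ≠ 0) (i j : Fin n) :
    ∑ k, A⁻¹ i k * A k j = if i = j then 1 else 0 := by
  have := congr_fun (congr_fun (Matrix.nonsing_inv_mul A (isUnit_iff_ne_zero.2 hdet)) i) j
  rwa [Matrix.mul_apply, Matrix.one_apply] at this

/-- The lowering factor `g_{ml}` cancels `g^{il}`, leaving the trace over `i = m`. No compatibility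
of `Γ` with `G` is involved, so this also covers the weighted connection. -/
lemma scalarContraction_connCurvatureLow {G : 𝔼 → Matrix (Fin n) (Fin n) ℝ}
    {Γ : 𝔼 → Fin n → Fin n → Fin n → ℝ} {y : 𝔼}
    (hΓ : ∀ i j k, ContDiffAt ℝ ∞ (fun z => Γ z i j k) y) (hs : (G y).IsSymm)
    (hdet : (G y).det ≠ 0) :
    scalarContraction (G y) (connCurvatureLow G Γ y) =
      contraction (G y) fun v w => ricciForm (fun z => bilinMap (Γ z)) y v w := by
  unfold scalarContraction contraction ricciContraction
  refine Finset.sum_congr rfl fun j _ => Finset.sum_congr rfl fun k _ => ?_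
  congr 1
  simp only [ricciForm_apply]
  refine Finset.sum_congr rfl fun i _ => ?_
  simp only [connCurvatureLow, connCurvature_eq hΓ, Finset.mul_sum]
  rw [Finset.sum_comm]
  have : ∀ m, ∑ l, (G y)⁻¹ i l * (G y m l *
      curvatureAt (fun z => bilinMap (Γ z)) y (stdVec i) (stdVec j) (stdVec k) m) =
      (if i = m then 1 else 0) *
        curvatureAt (fun z => bilinMap (Γ z)) y (stdVec i) (stdVec j) (stdVec k) m := by
    intro m
    rw [← sum_inv_mul hdet, Finset.sum_mul]
    exact Finset.sum_congr rfl fun l _ => by rw [hs.apply]; ring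
  simp [this]

/-- As `g^{il} g_{jl}` is the identity, each correction term contributes `-aⱼ aₖ` to the Ricci
contraction. -/
lemma scalarContraction_sub_gradient {A : Matrix (Fin n) (Fin n) ℝ} (hs : A.IsSymm)
    (hdet : A.det ≠ 0) (T : Fin n → Fin n → Fin n → Fin n → ℝ) (a : Fin n → ℝ) :
    scalarContraction A (fun i j k l => T i j k l - a i * a k * A j l - a i * a j * A k l) =
      scalarContraction A T - 2 * ∑ i, ∑ j, A⁻¹ i j * (a i * a j) := by
  have h1 : ∀ i k, ∑ l, A⁻¹ i l * A k l = if i = k then 1 else 0 := fun i k => by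
    rw [← sum_inv_mul hdet]
    exact Finset.sum_congr rfl fun l _ => by rw [hs.apply]
  have h2 : ∀ j k, ricciContraction A
      (fun i j k l => T i j k l - a i * a k * A j l - a i * a j * A k l) j k =
      ricciContraction A T j k - 2 * (a j * a k) := by
    intro j k
    have h3 : ∀ i j k, ∑ l, A⁻¹ i l * (T i j k l - a i * a k * A j l - a i * a j * A k l) =
        ∑ l, A⁻¹ i l * T i j k l - (a i * a k * if i = j then 1 else 0)
          - (a i * a j * if i = k then 1 else 0) := by
      intro i j k
      rw [← h1 i j, ← h1 i k, Finset.mul_sum, Finset.mul_sum, ← Finset.sum_sub_distrib,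
        ← Finset.sum_sub_distrib]
      exact Finset.sum_congr rfl fun l _ => by ring
    simp only [ricciContraction, h3, Finset.sum_sub_distrib]
    simp
    ring
  simp only [scalarContraction, h2, mul_sub, Finset.sum_sub_distrib, Finset.mul_sum]
  congr 1
  exact Finset.sum_congr rfl fun i _ => Finset.sum_congr rfl fun j _ => by ring

lemma contraction_gradForm_nonneg {A : Matrix (Fin n) (Fin n) ℝ} (hA : A.PosDef) (f : 𝔼 → ℝ)
    (y : 𝔼) : 0 ≤ contraction A fun v w => gradForm f y v w := by
  set a : Fin n → ℝ := fun i => fderiv ℝ f y (stdVec i) with ha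
  have h : contraction A (fun v w => gradForm f y v w) = star a ⬝ᵥ A⁻¹.mulVec a := by
    simp only [contraction, gradForm_apply, dotProduct, Matrix.mulVec, Finset.mul_sum, star_trivial,
      ha]
    exact Finset.sum_congr rfl fun i _ => Finset.sum_congr rfl fun j _ => by ring
  rw [h]
  exact hA.inv.posSemidef.dotProduct_mulVec_nonneg a

/-- The coefficients of the connection `∇_X Y - (Y f) X - (X f) Y`. -/
def localWeightedChristoffel (G : 𝔼 → Matrix (Fin n) (Fin n) ℝ) (f : 𝔼 → ℝ) (y : 𝔼)
    (i j k : Fin n) : ℝ :=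
  localChristoffel G y i j k - partialDeriv j f y * (if k = i then 1 else 0)
    - partialDeriv i f y * (if k = j then 1 else 0)

lemma bilinMap_localWeightedChristoffel (G : 𝔼 → Matrix (Fin n) (Fin n) ℝ) (f : 𝔼 → ℝ)
    (y v w : 𝔼) :
    bilinMap (localWeightedChristoffel G f y) v w =
      leviCivita G y v w - fderiv ℝ f y w • v - fderiv ℝ f y v • w := by
  let R : 𝔼 →L[ℝ] 𝔼 →L[ℝ] 𝔼 := leviCivita G y
    - ((fderiv ℝ f y).smulRight (ContinuousLinearMap.id ℝ 𝔼)).flip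
    - (fderiv ℝ f y).smulRight (ContinuousLinearMap.id ℝ 𝔼)
  have : bilinMap (localWeightedChristoffel G f y) = R := by
    refine clm_ext₂ fun i j => ?_
    ext k
    simp [R, localWeightedChristoffel, leviCivita, partialDeriv, stdVec]
  rw [this]
  rfl

/-- Let `Q = Hess f + df ⊗ df`. In the trace over `x`, the term `Q(v, w)x` gives `n Q(v, w)` and
`-Q(x, w)v` gives `-Q(v, w)`, whence the factor `n - 1`. -/
theorem localScalar_weighted {G : 𝔼 → Matrix (Fin n) (Fin n) ℝ} {U : Set 𝔼}
    (hG : IsMetricOn G U) {f : 𝔼 → ℝ} {y : 𝔼} (hy : y ∈ U) (hf : ContDiffAt ℝ ∞ f y) :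
    scalarContraction (G y) (connCurvatureLow G (localWeightedChristoffel G f) y) =
      localScalar G y + ((n : ℝ) - 1) * (localGradNormSq G f y + localLaplacian G f y) := by
  have hΓ : ∀ i j k, ContDiffAt ℝ ∞ (fun z => localWeightedChristoffel G f z i j k) y :=
    fun i j k => ((contDiffAt_localChristoffel (hG.contDiffAt y hy) (hG.det_ne_zero hy) i j k).sub
      ((contDiffAt_partialDeriv hf j).mul contDiffAt_const)).sub
      ((contDiffAt_partialDeriv hf i).mul contDiffAt_const)
  rw [scalarContraction_connCurvatureLow hΓ (hG.symm y) (hG.det_ne_zero hy)]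
  have key : ∀ v w, ricciForm (fun z => bilinMap (localWeightedChristoffel G f z)) y v w =
      ricciForm (leviCivita G) y v w
        + ((n : ℝ) - 1) * (gradForm f y v w + hessianForm G f y v w) := by
    intro v w
    rw [ricciForm_apply, ricciForm_apply]
    have h1 := fun x => curvatureAt_weighted
      (W := fun z => bilinMap (localWeightedChristoffel G f z))
      (hf.of_le (natCast_le_infty 2)) (hG.differentiableAt_leviCivita hy)
      ((contDiffAt_bilinMap hΓ).differentiableAt (by simp)) (leviCivita_symm hG.symm y)
      (Eventually.of_forall fun z v w => bilinMap_localWeightedChristoffel G f z v w) x v w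
    have h2 : ∀ x, fderiv ℝ (fderiv ℝ f) y x w - fderiv ℝ f y (leviCivita G y x w)
          + fderiv ℝ f y x * fderiv ℝ f y w = (hessianForm G f y + gradForm f y) x w :=
      fun x => rfl
    simp only [h2] at h1
    simp only [h1, PiLp.add_apply, PiLp.sub_apply, PiLp.smul_apply, smul_eq_mul,
      Finset.sum_add_distrib, Finset.sum_sub_distrib]
    have h3 : ∑ i, (hessianForm G f y + gradForm f y) (stdVec i) w * v i =
        (hessianForm G f y + gradForm f y) v w := by
      conv_rhs => rw [← sum_smul_stdVec v, map_sum, _root_.sum_apply]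
      exact Finset.sum_congr rfl fun i _ => by
        rw [map_smul, _root_.smul_apply, smul_eq_mul, mul_comm]
    rw [h3]
    simp [stdVec]
    ring
  simp only [key, contraction, localScalar, localGradNormSq, localLaplacian]
  rw [← Finset.sum_add_distrib, Finset.mul_sum, ← Finset.sum_add_distrib]
  refine Finset.sum_congr rfl fun i _ => ?_
  rw [← Finset.sum_add_distrib, Finset.mul_sum, ← Finset.sum_add_distrib]
  exact Finset.sum_congr rfl fun j _ => by ring

end ScalarIdentities

/-! ### The Laplacian as a divergence on ℝⁿ -/

section Divergence

/-- Jacobi's formula on a line. -/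
lemma hasDerivAt_det_line {A : Matrix (Fin n) (Fin n) ℝ} (hA : A.det ≠ 0)
    (D : Matrix (Fin n) (Fin n) ℝ) :
    HasDerivAt (fun t : ℝ => (A + t • D).det) (A.det * (A⁻¹ * D).trace) 0 := by
  have h : ∀ t : ℝ, (A + t • D).det = A.det * (1 + t • (A⁻¹ * D)).det := by
    intro t
    rw [← Matrix.det_mul, mul_add, mul_one, Matrix.mul_smul,
      Matrix.mul_nonsing_inv_cancel_left _ _ (isUnit_iff_ne_zero.2 hA)]
  simp only [h]
  refine HasDerivAt.const_mul _ ?_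
  -- `P` is the remainder in `det(1 + tM) = 1 + t tr M + t² P(t)`; it does not affect the derivative
  -- at `0`.
  set P := (Matrix.det (1 + (Polynomial.X : Polynomial ℝ) • (A⁻¹ * D).map Polynomial.C)).divX.divX
    with hP
  have h0 : (fun t : ℝ => (1 + t • (A⁻¹ * D)).det) =
      fun t => 1 + (A⁻¹ * D).trace * t + P.eval t * t ^ 2 :=
    funext fun t => Matrix.det_one_add_smul t _
  rw [h0]
  have h1 := ((hasDerivAt_id (0 : ℝ)).const_mul (A⁻¹ * D).trace).const_add 1
  have h2 := (P.hasDerivAt 0).mul (hasDerivAt_pow 2 (0 : ℝ))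
  have h3 := h1.add h2
  simp at h3
  exact h3

/-- Jacobi's formula. -/
lemma fderiv_det {G : 𝔼 → Matrix (Fin n) (Fin n) ℝ} {y : 𝔼}
    (hG : ∀ i j, DifferentiableAt ℝ (fun z => G z i j) y) (hdet : (G y).det ≠ 0) (v : 𝔼) :
    fderiv ℝ (fun z => (G z).det) y v =
      (G y).det * ((G y)⁻¹ * Matrix.of fun i j => fderiv ℝ (fun z => G z i j) y v).trace := by
  let d : (Fin n → Fin n → ℝ) → ℝ := fun A => (Matrix.of A).det
  have hd : ContDiff ℝ 1 d := by
    simp only [d, Matrix.det_apply]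
    exact ContDiff.sum fun σ _ =>
      (contDiff_prod fun i _ => contDiff_apply_apply _ _ _ _).const_smul _
  have hG' : HasFDerivAt (fun z => (fun i j => G z i j : Fin n → Fin n → ℝ))
      (ContinuousLinearMap.pi fun i => ContinuousLinearMap.pi fun j =>
        fderiv ℝ (fun z => G z i j) y) y :=
    hasFDerivAt_pi.2 fun i => hasFDerivAt_pi.2 fun j => (hG i j).hasFDerivAt
  have hdd := (hd.differentiable (by norm_num) (fun i j => G y i j)).hasFDerivAt
  have h1 := (HasFDerivAt.comp (g := d) y hdd hG').fderiv
  have h2 : (d ∘ fun z => (fun i j => G z i j : Fin n → Fin n → ℝ)) = fun z => (G z).det := rfl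
  rw [h2] at h1
  rw [h1]
  set D : Matrix (Fin n) (Fin n) ℝ := Matrix.of fun i j => fderiv ℝ (fun z => G z i j) y v with hD
  have h3 := hasDerivAt_det_line hdet D
  -- By the chain rule only the derivative of `det` in the direction `D` is needed, and the line `G
  -- y + tD` computes it.
  have h4 : HasDerivAt (fun t : ℝ => (fun i j => G y i j + t * D i j : Fin n → Fin n → ℝ))
      (fun i j => D i j) 0 := by
    refine hasDerivAt_pi.2 fun i => hasDerivAt_pi.2 fun j => ?_
    simpa using ((hasDerivAt_id (0 : ℝ)).mul_const (D i j)).const_add (G y i j)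
  have hdd' : HasFDerivAt d (fderiv ℝ d fun i j => G y i j)
      ((fun t : ℝ => (fun i j => G y i j + t * D i j : Fin n → Fin n → ℝ)) 0) := by
    simpa using hdd
  exact (hdd'.comp_hasDerivAt 0 h4).unique h3

/-- Differentiate `G G⁻¹ = 1`, valid near `y`, and solve for the derivative of `G⁻¹`. -/
lemma fderiv_inv_entry {G : 𝔼 → Matrix (Fin n) (Fin n) ℝ} {U : Set 𝔼} (hG : IsMetricOn G U)
    {y : 𝔼} (hy : y ∈ U) (v : 𝔼) (i j : Fin n) :
    fderiv ℝ (fun z => (G z)⁻¹ i j) y v =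
      - ∑ a, ∑ b, (G y)⁻¹ i a * fderiv ℝ (fun z => G z a b) y v * (G y)⁻¹ b j := by
  have hGd : ∀ i j, DifferentiableAt ℝ (fun z => G z i j) y :=
    fun i j => (hG.contDiffAt y hy i j).differentiableAt (by simp)
  have hId : ∀ i j, DifferentiableAt ℝ (fun z => (G z)⁻¹ i j) y := fun i j =>
    (contDiffAt_inv (hG.contDiffAt y hy) (hG.det_ne_zero hy) i j).differentiableAt (by simp)
  set D : Matrix (Fin n) (Fin n) ℝ := Matrix.of fun i j => fderiv ℝ (fun z => G z i j) y v with hD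
  set I : Matrix (Fin n) (Fin n) ℝ := Matrix.of fun i j => fderiv ℝ (fun z => (G z)⁻¹ i j) y v
    with hI
  have h1 : D * (G y)⁻¹ + G y * I = 0 := by
    ext a b
    have h2 : (fun z => ∑ c, G z a c * (G z)⁻¹ c b) =ᶠ[𝓝 y]
        fun _ => (1 : Matrix (Fin n) (Fin n) ℝ) a b := by
      filter_upwards [hG.isOpen.mem_nhds hy] with z hz
      rw [← Matrix.mul_nonsing_inv (G z) (isUnit_iff_ne_zero.2 (hG.det_ne_zero hz)),
        Matrix.mul_apply]
    have h3 := HasFDerivAt.fun_sum (u := Finset.univ)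
      fun c _ => (hGd a c).hasFDerivAt.mul (hId c b).hasFDerivAt
    have h4 := DFunLike.congr_fun (h3.unique ((hasFDerivAt_const _ y).congr_of_eventuallyEq h2)) v
    simp only [_root_.sum_apply, _root_.add_apply, _root_.smul_apply, smul_eq_mul] at h4
    simp only [Matrix.add_apply, Matrix.mul_apply, hD, hI, Matrix.of_apply, Matrix.zero_apply]
    rw [← Finset.sum_add_distrib]
    refine Eq.trans (Finset.sum_congr rfl fun c _ => ?_) h4
    ring
  have h5 : I = -((G y)⁻¹ * D * (G y)⁻¹) := by
    have := congrArg ((G y)⁻¹ * ·) h1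
    simp only [mul_add, mul_zero,
      Matrix.nonsing_inv_mul_cancel_left _ _ (isUnit_iff_ne_zero.2 (hG.det_ne_zero hy))] at this
    rw [mul_assoc]
    exact eq_neg_of_add_eq_zero_right this
  have h6 := congr_fun (congr_fun h5 i) j
  rw [Matrix.neg_apply, Matrix.mul_apply] at h6
  simp only [Matrix.mul_apply, Finset.sum_mul] at h6
  rw [Finset.sum_comm] at h6
  exact h6

/-- The component `√(det g) g^{ij} ∂ⱼ f` of the gradient density. -/
def gradDensity (G : 𝔼 → Matrix (Fin n) (Fin n) ℝ) (f : 𝔼 → ℝ) (i : Fin n) (z : 𝔼) : ℝ :=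
  √(G z).det * ∑ j, (G z)⁻¹ i j * partialDeriv j f z

lemma contDiffAt_gradDensity {G : 𝔼 → Matrix (Fin n) (Fin n) ℝ} {U : Set 𝔼}
    (hG : IsMetricOn G U) {f : 𝔼 → ℝ} {y : 𝔼} (hy : y ∈ U) (hf : ContDiffAt ℝ ∞ f y)
    (i : Fin n) : ContDiffAt ℝ ∞ (gradDensity G f i) y :=
  ((contDiffAt_det (hG.contDiffAt y hy)).sqrt (hG.det_ne_zero hy)).mul
    (ContDiffAt.sum fun j _ => (contDiffAt_inv (hG.contDiffAt y hy) (hG.det_ne_zero hy) i j).mul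
      (contDiffAt_partialDeriv hf j))

/-- The Laplacian in divergence form. -/
theorem sqrt_det_mul_localLaplacian {G : 𝔼 → Matrix (Fin n) (Fin n) ℝ} {U : Set 𝔼}
    (hG : IsMetricOn G U) {f : 𝔼 → ℝ} {y : 𝔼} (hy : y ∈ U) (hf : ContDiffAt ℝ ∞ f y) :
    √(G y).det * localLaplacian G f y = ∑ i, partialDeriv i (gradDensity G f i) y := by
  have hGd : ∀ i j, DifferentiableAt ℝ (fun z => G z i j) y :=
    fun i j => (hG.contDiffAt y hy i j).differentiableAt (by simp)
  have hId : ∀ i j, DifferentiableAt ℝ (fun z => (G z)⁻¹ i j) y := fun i j =>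
    (contDiffAt_inv (hG.contDiffAt y hy) (hG.det_ne_zero hy) i j).differentiableAt (by simp)
  have hpd : ∀ j, DifferentiableAt ℝ (fun z => partialDeriv j f z) y := fun j =>
    (contDiffAt_partialDeriv hf j).differentiableAt (by simp)
  have hdd : DifferentiableAt ℝ (fun z => (G z).det) y :=
    (contDiffAt_det (hG.contDiffAt y hy)).differentiableAt (by simp)
  have hpos : 0 < (G y).det := (hG.posDef y hy).det_pos
  set g := (G y)⁻¹ with hg
  set s := √(G y).det with hs
  let D : Fin n → Fin n → Fin n → ℝ := fun i a b => partialDeriv i (fun z => G z a b) y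
  let F : Fin n → ℝ := fun j => partialDeriv j f y
  let H : Fin n → Fin n → ℝ := fun i j => partialDeriv i (fun z => partialDeriv j f z) y
  have hgs : ∀ i j, g i j = g j i := inv_symm (hG.symm y)
  have hDs : ∀ i a b, D i a b = D i b a := fun i a b => by
    have : (fun z => G z a b) = fun z => G z b a := funext fun z => (hG.symm z).apply b a
    simp only [D, this]
  have hsqrt : ∀ i, fderiv ℝ (fun z => √(G z).det) y (stdVec i) =
      s * ((1 / 2) * ∑ a, ∑ b, g a b * D i a b) := by
    intro i
    rw [(hdd.hasFDerivAt.sqrt hpos.ne').fderiv, _root_.smul_apply, fderiv_det hGd hpos.ne']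
    have h1 : ((G y)⁻¹ * Matrix.of fun a b => fderiv ℝ (fun z => G z a b) y (stdVec i)).trace =
        ∑ a, ∑ b, g a b * D i a b := by
      simp only [Matrix.trace, Matrix.diag, Matrix.mul_apply, Matrix.of_apply]
      exact Finset.sum_congr rfl fun a _ => Finset.sum_congr rfl fun b _ => by rw [hDs]; rfl
    rw [h1, smul_eq_mul, ← hs]
    have h2 : s * s = (G y).det := Real.mul_self_sqrt hpos.le
    have h3 : s ≠ 0 := (Real.sqrt_pos.2 hpos).ne'
    rw [← h2]
    field_simp
  have hdiv : ∀ i, partialDeriv i (gradDensity G f i) y =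
      s * ((1 / 2) * ∑ a, ∑ b, g a b * D i a b) * (∑ j, g i j * F j)
      + s * ∑ j, (g i j * H i j - (∑ a, ∑ b, g i a * D i a b * g b j) * F j) := by
    intro i
    have h1 := HasFDerivAt.fun_sum (u := Finset.univ)
      fun j _ => (hId i j).hasFDerivAt.mul (hpd j).hasFDerivAt
    have h2 : HasFDerivAt (gradDensity G f i) _ y := (hdd.sqrt hpos.ne').hasFDerivAt.mul h1
    rw [partialDeriv, h2.fderiv]
    simp only [_root_.add_apply, _root_.smul_apply, _root_.sum_apply, smul_eq_mul]
    rw [hsqrt i, add_comm, mul_comm (∑ j, _)]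
    congr 2
    refine Finset.sum_congr rfl fun j _ => ?_
    rw [fderiv_inv_entry hG hy]
    change g i j * H i j + F j * -(∑ a, ∑ b, g i a * D i a b * g b j) = _
    ring
  -- With `P_l = g^{ij} ∂ᵢ g_{jl}` and `Q_l = g^{ij} ∂_l g_{ij}`, both sides reduce to `√det g`
  -- times `g^{ij} ∂ᵢ∂ⱼf - g^{kl} ∂ₖf (P_l - Q_l / 2)`. On the divergence side `P` comes from
  -- differentiating `g^{ij}`, and `Q` from differentiating `√det g`.
  let P : Fin n → ℝ := fun l => ∑ i, ∑ j, g i j * D i j l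
  let Q : Fin n → ℝ := fun l => ∑ i, ∑ j, g i j * D l i j
  have hΓ : ∀ k, ∑ i, ∑ j, g i j * localChristoffel G y i j k =
      ∑ l, g k l * (P l - (1 / 2) * Q l) := by
    intro k
    have h1 : ∀ l, P l = ∑ i, ∑ j, g i j * D j i l := fun l => by
      simp only [P]
      rw [Finset.sum_comm]
      exact Finset.sum_congr rfl fun i _ => Finset.sum_congr rfl fun j _ => by rw [hgs]
    have h2 : ∀ l, P l - (1 / 2) * Q l =
        ∑ i, ∑ j, g i j * ((1 / 2) * (D i j l + D j i l - D l i j)) := by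
      intro l
      have h3 : ∑ i, ∑ j, g i j * ((1 / 2) * (D i j l + D j i l - D l i j)) =
          (1 / 2) * P l + (1 / 2) * (∑ i, ∑ j, g i j * D j i l) - (1 / 2) * Q l := by
        simp only [P, Q, Finset.mul_sum, ← Finset.sum_add_distrib, ← Finset.sum_sub_distrib]
        exact Finset.sum_congr rfl fun i _ => Finset.sum_congr rfl fun j _ => by ring
      rw [h3, ← h1]
      ring
    simp only [h2, Finset.mul_sum, localChristoffel]
    have : ∀ i, ∑ j, ∑ l, g i j * (1 / 2 * (g k l * (D i j l + D j i l - D l i j))) =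
      ∑ l, ∑ j, g k l * (g i j * (1 / 2 * (D i j l + D j i l - D l i j))) := fun i => by
      rw [Finset.sum_comm]
      exact Finset.sum_congr rfl fun i _ => Finset.sum_congr rfl fun j _ => by ring
    refine Eq.trans (Finset.sum_congr rfl fun i _ => this i) ?_
    rw [Finset.sum_comm]
  have hL : localLaplacian G f y = ∑ i, ∑ j, g i j * H i j
      - ∑ k, F k * ∑ l, g k l * (P l - (1 / 2) * Q l) := by
    have h1 : ∀ i j, hessianForm G f y (stdVec i) (stdVec j) =
        H i j - ∑ k, localChristoffel G y i j k * F k := by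
      intro i j
      rw [hessianForm_apply, fderiv_apply_eq_sum f y (leviCivita G y _ _),
        ← partialDeriv_partialDeriv (hf.of_le (natCast_le_infty 2))]
      simp only [leviCivita, bilinMap_stdVec, H, F]
    have h2 : ∑ i, ∑ j, g i j * ∑ k, localChristoffel G y i j k * F k =
        ∑ k, F k * ∑ i, ∑ j, g i j * localChristoffel G y i j k := by
      simp only [Finset.mul_sum]
      refine Eq.trans (Finset.sum_congr rfl fun i _ => Finset.sum_comm) ?_
      rw [Finset.sum_comm]
      exact Finset.sum_congr rfl fun i _ => Finset.sum_congr rfl fun j _ =>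
        Finset.sum_congr rfl fun k _ => by ring
    simp only [hΓ] at h2
    rw [← h2]
    simp only [localLaplacian, contraction, h1, mul_sub, Finset.sum_sub_distrib, hg]
  have hR : ∑ i, partialDeriv i (gradDensity G f i) y = s * (∑ i, ∑ j, g i j * H i j
      - ∑ k, F k * ∑ l, g k l * P l + (1 / 2) * ∑ k, F k * ∑ l, g k l * Q l) := by
    simp only [hdiv, Finset.sum_add_distrib, Finset.sum_sub_distrib, mul_sub]
    have h1 : ∑ i, s * ((1 / 2) * ∑ a, ∑ b, g a b * D i a b) * (∑ j, g i j * F j) =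
        s * ((1 / 2) * ∑ k, F k * ∑ l, g k l * Q l) := by
      change ∑ i, s * ((1 / 2) * Q i) * (∑ j, g i j * F j) = _
      simp only [Finset.mul_sum]
      rw [Finset.sum_comm]
      exact Finset.sum_congr rfl fun i _ => Finset.sum_congr rfl fun j _ => by rw [hgs]; ring
    have h2 : ∑ i, s * ∑ j, (∑ a, ∑ b, g i a * D i a b * g b j) * F j =
        s * ∑ k, F k * ∑ l, g k l * P l := by
      rw [← Finset.mul_sum, Finset.sum_comm]
      congr 1
      refine Finset.sum_congr rfl fun j _ => ?_
      rw [← Finset.sum_mul, mul_comm]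
      congr 1
      simp only [P, Finset.mul_sum]
      refine Eq.trans (Finset.sum_congr rfl fun i _ => Finset.sum_comm) ?_
      rw [Finset.sum_comm]
      exact Finset.sum_congr rfl fun b _ => Finset.sum_congr rfl fun i _ =>
        Finset.sum_congr rfl fun a _ => by rw [hgs j b]; ring
    rw [h1, h2, ← Finset.mul_sum]
    ring
  rw [hL, hR]
  simp only [mul_sub, Finset.sum_sub_distrib, Finset.mul_sum]
  have : ∀ k l, F k * (g k l * (1 / 2 * Q l)) = 1 / 2 * (F k * (g k l * Q l)) :=
    fun k l => by ring
  simp only [this, mul_add, mul_sub, Finset.mul_sum]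
  ring

/-- Integration by parts against the constant function `1`. -/
lemma integral_partialDeriv_eq_zero {V : 𝔼 → ℝ} (hV : ContDiff ℝ 1 V)
    (hc : HasCompactSupport V) (i : Fin n) : ∫ y, partialDeriv i V y = 0 := by
  have hcont : Continuous fun y => fderiv ℝ V y (stdVec i) :=
    (hV.continuous_fderiv (by norm_num)).clm_apply continuous_const
  have hc' : HasCompactSupport fun y => fderiv ℝ V y (stdVec i) :=
    hc.fderiv_apply ℝ (stdVec i)
  have h := integral_mul_fderiv_eq_neg_fderiv_mul_of_integrable (μ := (volume : Measure 𝔼))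
    (f := fun _ => (1 : ℝ)) (g := V) (v := stdVec i) (by simp)
    (by simpa using hcont.integrable_of_hasCompactSupport hc')
    (by simpa using hV.continuous.integrable_of_hasCompactSupport hc)
    (fun x _ => differentiableAt_const _) (fun x _ => hV.differentiable (by norm_num) x)
  simpa [partialDeriv, stdVec] using h

lemma integrable_partialDeriv {V : 𝔼 → ℝ} (hV : ContDiff ℝ 1 V)
    (hc : HasCompactSupport V) (i : Fin n) : Integrable (partialDeriv i V) :=
  ((hV.continuous_fderiv (by norm_num)).clm_apply continuous_const).integrable_of_hasCompactSupport
    (hc.fderiv_apply ℝ (stdVec i))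

lemma localLaplacian_eq_zero {G : 𝔼 → Matrix (Fin n) (Fin n) ℝ} {f : 𝔼 → ℝ} {y : 𝔼}
    (h0 : f =ᶠ[𝓝 y] fun _ => 0) : localLaplacian G f y = 0 := by
  have h1 : fderiv ℝ f =ᶠ[𝓝 y] fun _ => 0 := by
    filter_upwards [h0.eventuallyEq_nhds] with z hz
    rw [hz.fderiv_eq]
    simp
  simp [localLaplacian, contraction, h1.fderiv_eq, h1.self_of_nhds]

/-- The integral of the Laplacian of a compactly supported function vanishes. -/
theorem integral_localLaplacian_eq_zero {G : 𝔼 → Matrix (Fin n) (Fin n) ℝ} {U : Set 𝔼}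
    (hG : IsMetricOn G U) {f : 𝔼 → ℝ} (hf : ContDiff ℝ ∞ f) (hc : HasCompactSupport f)
    (hs : tsupport f ⊆ U) : ∫ y, √(G y).det * localLaplacian G f y = 0 := by
  have hzero : ∀ y ∉ tsupport f, ∀ i, gradDensity G f i =ᶠ[𝓝 y] fun _ => 0 := by
    intro y hy i
    filter_upwards [(isClosed_tsupport f).isOpen_compl.mem_nhds hy] with z hz
    have : fderiv ℝ f z = 0 := by
      rw [(notMem_tsupport_iff_eventuallyEq.1 hz).fderiv_eq]
      simp
    simp [gradDensity, partialDeriv, this]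
  -- `G` is controlled only on `U`, but off the support of `f` the density vanishes locally, so it
  -- is globally regular.
  have hV : ∀ i, ContDiff ℝ 1 (gradDensity G f i) := fun i => contDiff_iff_contDiffAt.2 fun y => by
    by_cases hy : y ∈ tsupport f
    · exact (contDiffAt_gradDensity hG (hs hy) hf.contDiffAt i).of_le (natCast_le_infty 1)
    · exact contDiffAt_const.congr_of_eventuallyEq (hzero y hy i)
  have hVc : ∀ i, HasCompactSupport (gradDensity G f i) := fun i =>
    hc.of_isClosed_subset (isClosed_tsupport _) <|
      closure_minimal (fun y hy => by
        by_contra h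
        exact hy (hzero y h i).self_of_nhds) (isClosed_tsupport f)
  have heq : ∀ y, √(G y).det * localLaplacian G f y =
      ∑ i, partialDeriv i (gradDensity G f i) y := by
    intro y
    by_cases hy : y ∈ tsupport f
    · exact sqrt_det_mul_localLaplacian hG (hs hy) hf.contDiffAt
    · have h0 := localLaplacian_eq_zero (G := G) (notMem_tsupport_iff_eventuallyEq.1 hy)
      have h2 : ∀ i, partialDeriv i (gradDensity G f i) y = 0 := fun i => by
        rw [partialDeriv, (hzero y hy i).fderiv_eq]
        simp
      simp [h0, h2]
  simp only [heq]
  rw [integral_finsetSum _ fun i _ => integrable_partialDeriv (hV i) (hVc i) i]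
  simp [integral_partialDeriv_eq_zero (hV _) (hVc _)]

end Divergence

/-! ### The metric in charts; transition maps as isometries -/

section Charts

variable {M : Type*} [TopologicalSpace M] [ChartedSpace (EuclideanSpace ℝ (Fin n)) M]
  [IsManifold (𝓡 n) ∞ M]

lemma contMDiffAt_chart_symm {φ : OpenPartialHomeomorph M 𝔼} (hφ : φ ∈ atlas 𝔼 M) {y : 𝔼}
    (hy : y ∈ φ.target) : ContMDiffAt (𝓡 n) (𝓡 n) ∞ φ.symm y :=
  (contMDiffOn_symm_of_mem_maximalAtlas
    (IsManifold.subset_maximalAtlas hφ)).contMDiffAt (φ.open_target.mem_nhds hy)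

lemma contMDiffAt_chart {φ : OpenPartialHomeomorph M 𝔼} (hφ : φ ∈ atlas 𝔼 M) {p : M}
    (hp : p ∈ φ.source) : ContMDiffAt (𝓡 n) (𝓡 n) ∞ φ p :=
  (contMDiffOn_of_mem_maximalAtlas
    (IsManifold.subset_maximalAtlas hφ)).contMDiffAt (φ.open_source.mem_nhds hp)

/-- The coordinate field is the tangent map of `φ.symm` applied to a constant section, and tangent
maps of smooth maps are smooth. -/
lemma contMDiffAt_coordVector {φ : OpenPartialHomeomorph M 𝔼} (hφ : φ ∈ atlas 𝔼 M) {y : 𝔼}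
    (hy : y ∈ φ.target) (i : Fin n) :
    ContMDiffAt (𝓡 n) ((𝓡 n).prod 𝓘(ℝ, 𝔼)) ∞
      (fun z => (Bundle.TotalSpace.mk' 𝔼 (φ.symm z) (coordVector φ z i) :
        TangentBundle (𝓡 n) M)) y := by
  have h0 : ContMDiffOn (𝓡 n) (𝓡 n) ∞ φ.symm φ.target := contMDiffOn_symm_of_mem_maximalAtlas
    (IsManifold.subset_maximalAtlas hφ)
  have h1 := h0.contMDiffOn_tangentMapWithin (m := ∞) le_rfl φ.open_target.uniqueMDiffOn
  have h2 : ContMDiff (𝓡 n) ((𝓡 n).prod 𝓘(ℝ, 𝔼)) ∞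
      (fun z : 𝔼 => (Bundle.TotalSpace.mk' 𝔼 z (stdVec i) : TangentBundle (𝓡 n) 𝔼)) :=
    contMDiff_vectorSpace_iff_contDiff.2 contDiff_const
  have h3 := h1.comp (h2.contMDiffOn (s := φ.target)) (fun z hz => hz)
  refine (h3.contMDiffAt (φ.open_target.mem_nhds hy)).congr_of_eventuallyEq ?_
  filter_upwards [φ.open_target.mem_nhds hy] with z hz
  rw [Function.comp_apply, tangentMapWithin_eq_tangentMap]
  · rfl
  · exact (φ.open_target.uniqueMDiffOn z hz)
  · exact (contMDiffAt_chart_symm hφ hz).mdifferentiableAt (by simp)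

lemma contDiffAt_metricCoeff (g : SmoothMetric n M) {φ : OpenPartialHomeomorph M 𝔼}
    (hφ : φ ∈ atlas 𝔼 M) {y : 𝔼} (hy : y ∈ φ.target) (i j : Fin n) :
    ContDiffAt ℝ ∞ (fun z => metricCoeff g φ z i j) y := by
  have h : ContMDiffAt (𝓡 n) ((𝓡 n).prod 𝓘(ℝ, ℝ)) ∞
      (fun z => Bundle.TotalSpace.mk' ℝ (E := Bundle.Trivial M ℝ) (φ.symm z)
        (g.inner (φ.symm z) (coordVector φ z i) (coordVector φ z j))) y := by
    apply ContMDiffAt.clm_bundle_apply₂ (F₁ := 𝔼) (F₂ := 𝔼)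
    · exact ContMDiffAt.comp y g.contMDiff.contMDiffAt (contMDiffAt_chart_symm hφ hy)
    · exact contMDiffAt_coordVector hφ hy i
    · exact contMDiffAt_coordVector hφ hy j
  rw [Bundle.contMDiffAt_totalSpace] at h
  exact h.2.contDiffAt

lemma bilinForm_metricCoeff (g : SmoothMetric n M) (φ : OpenPartialHomeomorph M 𝔼) (y v w : 𝔼) :
    bilinForm (metricCoeff g φ y) v w = g.inner (φ.symm y)
      (mfderiv (𝓡 n) (𝓡 n) φ.symm y v) (mfderiv (𝓡 n) (𝓡 n) φ.symm y w) := by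
  -- Tangent spaces are retyped as the model space, so that plain bilinearity applies.
  let A : 𝔼 →L[ℝ] 𝔼 := mfderiv (𝓡 n) (𝓡 n) φ.symm y
  let B : 𝔼 →L[ℝ] 𝔼 →L[ℝ] ℝ := g.inner (φ.symm y)
  change _ = B (A v) (A w)
  induction v using vec_induction with
  | hzero => simp
  | hadd a b ha hb => simp only [map_add, _root_.add_apply, ha, hb]
  | hsmul c a ha => simp only [map_smul, _root_.smul_apply, ha]
  | hstd i =>
  induction w using vec_induction with
  | hzero => simp
  | hadd a b ha hb => simp only [map_add, ha, hb]
  | hsmul c a ha => simp only [map_smul, ha]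
  | hstd j => rw [bilinForm_stdVec]; rfl

lemma mfderiv_chart_symm_injective {φ : OpenPartialHomeomorph M 𝔼} (hφ : φ ∈ atlas 𝔼 M) {y : 𝔼}
    (hy : y ∈ φ.target) : Function.Injective (mfderiv (𝓡 n) (𝓡 n) φ.symm y) :=
  (mdifferentiable_of_mem_atlas (I := 𝓡 n) hφ).symm.mfderiv_injective hy

lemma metricCoeff_symm (g : SmoothMetric n M) (φ : OpenPartialHomeomorph M 𝔼) (y : 𝔼) :
    (metricCoeff g φ y).IsSymm :=
  Matrix.IsSymm.ext fun _ _ => g.symm _ _ _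

lemma isMetricOn_metricCoeff (g : SmoothMetric n M) {φ : OpenPartialHomeomorph M 𝔼}
    (hφ : φ ∈ atlas 𝔼 M) : IsMetricOn (metricCoeff g φ) φ.target where
  isOpen := φ.open_target
  contDiffAt _ hy := contDiffAt_metricCoeff g hφ hy
  symm := metricCoeff_symm g φ
  posDef y hy := by
    refine Matrix.PosDef.of_dotProduct_mulVec_pos ?_ fun x hx => ?_
    · rw [Matrix.IsHermitian, Matrix.conjTranspose_eq_transpose_of_trivial]
      exact metricCoeff_symm g φ y
    · rw [star_dotProduct_mulVec, bilinForm_metricCoeff]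
      refine g.pos _ _ fun h => hx ?_
      have := mfderiv_chart_symm_injective hφ hy (h.trans (map_zero _).symm)
      exact congrArg WithLp.ofLp this

lemma IsMetricOn.mono {G : 𝔼 → Matrix (Fin n) (Fin n) ℝ} {U V : Set 𝔼} (hG : IsMetricOn G U)
    (hV : IsOpen V) (h : V ⊆ U) : IsMetricOn G V :=
  ⟨hV, fun y hy => hG.contDiffAt y (h hy), hG.symm, fun y hy => hG.posDef y (h hy)⟩

/-- Transition maps are isometries. -/
lemma isIsometryOn_transition (g : SmoothMetric n M) {φ φ' : OpenPartialHomeomorph M 𝔼}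
    (hφ : φ ∈ atlas 𝔼 M) (hφ' : φ' ∈ atlas 𝔼 M) :
    IsIsometryOn (metricCoeff g φ) (metricCoeff g φ') (φ.symm.trans φ').source φ'.target
      (φ' ∘ φ.symm) where
  mapsTo y hy := (φ.symm.trans φ').map_source hy |>.1
  contDiffAt y hy := by
    rw [OpenPartialHomeomorph.trans_source] at hy
    exact ((contMDiffAt_chart hφ' hy.2).comp y (contMDiffAt_chart_symm hφ hy.1)).contDiffAt
  metric y hy v w := by
    have hy' := hy
    rw [OpenPartialHomeomorph.trans_source] at hy'
    have hψ : ContMDiffAt (𝓡 n) (𝓡 n) ∞ (φ' ∘ φ.symm) y :=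
      (contMDiffAt_chart hφ' hy'.2).comp y (contMDiffAt_chart_symm hφ hy'.1)
    have hmem : (φ' ∘ φ.symm) y ∈ φ'.target := φ'.map_source hy'.2
    have hpt : φ'.symm ((φ' ∘ φ.symm) y) = φ.symm y := φ'.left_inv hy'.2
    rw [bilinForm_metricCoeff, bilinForm_metricCoeff]
    -- The chain rule for this factorisation carries coordinate vectors of `φ` to those of `φ'`
    -- through the derivative of the transition map.
    have hev : φ.symm =ᶠ[𝓝 y] φ'.symm ∘ (φ' ∘ φ.symm) := by
      filter_upwards [(φ.symm.trans φ').open_source.mem_nhds hy] with z hz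
      rw [OpenPartialHomeomorph.trans_source] at hz
      exact (φ'.left_inv hz.2).symm
    have hchain : ∀ v : 𝔼, (mfderiv (𝓡 n) (𝓡 n) φ.symm y v : 𝔼) =
        mfderiv (𝓡 n) (𝓡 n) φ'.symm ((φ' ∘ φ.symm) y) (fderiv ℝ (φ' ∘ φ.symm) y v) := by
      intro v
      have h1 := hev.mfderiv_eq (I := 𝓡 n) (I' := 𝓡 n)
      have h2 := mfderiv_comp y
        ((contMDiffAt_chart_symm hφ' hmem).mdifferentiableAt (by simp))
        (hψ.mdifferentiableAt (by simp))
      rw [← mfderiv_eq_fderiv]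
      exact (DFunLike.congr_fun h1 v).trans (DFunLike.congr_fun h2 v)
    -- The two base points are equal but not definitionally so; this moves the inner product between
    -- them.
    have hbase : ∀ (p q : M) (_ : p = q) (a b : 𝔼),
        (g.inner p : 𝔼 →L[ℝ] 𝔼 →L[ℝ] ℝ) a b = (g.inner q : 𝔼 →L[ℝ] 𝔼 →L[ℝ] ℝ) a b := by
      rintro p _ rfl a b
      rfl
    have := hbase _ _ hpt (mfderiv (𝓡 n) (𝓡 n) φ.symm y v) (mfderiv (𝓡 n) (𝓡 n) φ.symm y w)
    refine this.symm.trans ?_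
    rw [hchain v, hchain w]

end Charts

/-! ### Chart independence and continuity of the scalar quantities -/

section ScalarQuantities

variable {M : Type*} [TopologicalSpace M]

lemma mem_transition_source {φ φ' : OpenPartialHomeomorph M 𝔼} {p : M} (hp : p ∈ φ.source)
    (hp' : p ∈ φ'.source) : φ p ∈ (φ.symm.trans φ').source := by
  rw [OpenPartialHomeomorph.trans_source]
  exact ⟨φ.map_source hp, by simpa [φ.left_inv hp] using hp'⟩

variable [ChartedSpace (EuclideanSpace ℝ (Fin n)) M]

/-- Freezing the chart at `p` for all nearby points avoids the possibly discontinuous choice of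
preferred chart. -/
lemma continuous_of_forall_chart {F : M → ℝ} {L : OpenPartialHomeomorph M 𝔼 → 𝔼 → ℝ}
    (hF : ∀ φ ∈ atlas 𝔼 M, ∀ p ∈ φ.source, F p = L φ (φ p))
    (hL : ∀ φ ∈ atlas 𝔼 M, ∀ y ∈ φ.target, ContinuousAt (L φ) y) : Continuous F := by
  refine continuous_iff_continuousAt.2 fun p => ?_
  have hφ := chart_mem_atlas 𝔼 p
  have hp := mem_chart_source 𝔼 p
  have h : ContinuousAt (L (chartAt 𝔼 p) ∘ chartAt 𝔼 p) p :=
    (hL _ hφ _ ((chartAt 𝔼 p).map_source hp)).comp ((chartAt 𝔼 p).continuousAt hp)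
  exact h.congr (Filter.eventually_of_mem ((chartAt 𝔼 p).open_source.mem_nhds hp)
    fun q hq => (hF _ hφ q hq).symm)

variable [IsManifold (𝓡 n) ∞ M]

lemma contDiffAt_comp_chart_symm {u : M → ℝ} (hu : ContMDiff (𝓡 n) 𝓘(ℝ, ℝ) ∞ u)
    {φ : OpenPartialHomeomorph M 𝔼} (hφ : φ ∈ atlas 𝔼 M) {y : 𝔼} (hy : y ∈ φ.target) :
    ContDiffAt ℝ ∞ (fun z => u (φ.symm z)) y :=
  (hu.contMDiffAt.comp y (contMDiffAt_chart_symm hφ hy)).contDiffAt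

lemma isMetricOn_transition (g : SmoothMetric n M) {φ : OpenPartialHomeomorph M 𝔼}
    (hφ : φ ∈ atlas 𝔼 M) (φ' : OpenPartialHomeomorph M 𝔼) :
    IsMetricOn (metricCoeff g φ) (φ.symm.trans φ').source :=
  (isMetricOn_metricCoeff g hφ).mono (φ.symm.trans φ').open_source
    (by rw [OpenPartialHomeomorph.trans_source]; exact Set.inter_subset_left)

/-- The scalar curvature may be computed in any chart. -/
theorem scalarCurv_eq (g : SmoothMetric n M) {φ : OpenPartialHomeomorph M 𝔼}
    (hφ : φ ∈ atlas 𝔼 M) {p : M} (hp : p ∈ φ.source) :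
    scalarCurv g p = localScalar (metricCoeff g φ) (φ p) := by
  set φ₀ := chartAt 𝔼 p with hφ₀
  have hp₀ : p ∈ φ₀.source := mem_chart_source 𝔼 p
  have hφ₀a : φ₀ ∈ atlas 𝔼 M := chart_mem_atlas 𝔼 p
  have hG := isMetricOn_metricCoeff g hφ₀a
  have h1 : scalarCurv g p = localScalar (metricCoeff g φ₀) (φ₀ p) :=
    scalarContraction_connCurvatureLow (Γ := localChristoffel (metricCoeff g φ₀))
      (contDiffAt_localChristoffel (hG.contDiffAt _ (φ₀.map_source hp₀))
        (hG.det_ne_zero (φ₀.map_source hp₀))) (hG.symm _) (hG.det_ne_zero (φ₀.map_source hp₀))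
  have h2 := (isIsometryOn_transition g hφ₀a hφ).localScalar (isMetricOn_transition g hφ₀a φ)
    (isMetricOn_metricCoeff g hφ) (mem_transition_source hp₀ hp)
  rw [h1, h2, Function.comp_apply, φ₀.left_inv hp₀]

lemma laplacian_eq_chartAt (g : SmoothMetric n M) {u : M → ℝ}
    (hu : ContMDiff (𝓡 n) 𝓘(ℝ, ℝ) ∞ u) (p : M) :
    laplacian g u p = localLaplacian (metricCoeff g (chartAt 𝔼 p))
      (fun z => u ((chartAt 𝔼 p).symm z)) (chartAt 𝔼 p p) := by
  set φ := chartAt 𝔼 p with hφ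
  have hf := contDiffAt_comp_chart_symm hu (chart_mem_atlas 𝔼 p)
    (φ.map_source (mem_chart_source 𝔼 p))
  refine Finset.sum_congr rfl fun i _ => Finset.sum_congr rfl fun j _ => ?_
  congr 1
  change hessCoeff g u φ (φ p) i j = _
  simp only [hessianForm_apply]
  rw [← partialDeriv_partialDeriv (hf.of_le (natCast_le_infty 2)),
    fderiv_apply_eq_sum _ _ (leviCivita _ _ _ _)]
  simp only [leviCivita, bilinMap_stdVec]
  rfl

/-- The Laplacian may be computed in any chart. -/
theorem laplacian_eq (g : SmoothMetric n M) {u : M → ℝ} (hu : ContMDiff (𝓡 n) 𝓘(ℝ, ℝ) ∞ u)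
    {φ : OpenPartialHomeomorph M 𝔼} (hφ : φ ∈ atlas 𝔼 M) {p : M} (hp : p ∈ φ.source) :
    laplacian g u p = localLaplacian (metricCoeff g φ) (fun z => u (φ.symm z)) (φ p) := by
  rw [laplacian_eq_chartAt g hu]
  set φ₀ := chartAt 𝔼 p with hφ₀
  have hp₀ : p ∈ φ₀.source := mem_chart_source 𝔼 p
  have hφ₀a : φ₀ ∈ atlas 𝔼 M := chart_mem_atlas 𝔼 p
  have h2 := (isIsometryOn_transition g hφ₀a hφ).localLaplacian (isMetricOn_transition g hφ₀a φ)
    (isMetricOn_metricCoeff g hφ) (f := fun z => u (φ₀.symm z)) (f' := fun z => u (φ.symm z))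
    (fun y hy => contDiffAt_comp_chart_symm hu hφ hy) (fun y hy => by
      rw [OpenPartialHomeomorph.trans_source] at hy
      exact congrArg u (φ.left_inv hy.2).symm) (mem_transition_source hp₀ hp)
  rw [h2, Function.comp_apply, φ₀.left_inv hp₀]

/-- The norm of the gradient may be computed in any chart. -/
theorem gradNormSq_eq (g : SmoothMetric n M) {u : M → ℝ} (hu : ContMDiff (𝓡 n) 𝓘(ℝ, ℝ) ∞ u)
    {φ : OpenPartialHomeomorph M 𝔼} (hφ : φ ∈ atlas 𝔼 M) {p : M} (hp : p ∈ φ.source) :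
    gradNormSq g u p = localGradNormSq (metricCoeff g φ) (fun z => u (φ.symm z)) (φ p) := by
  set φ₀ := chartAt 𝔼 p with hφ₀
  have hp₀ : p ∈ φ₀.source := mem_chart_source 𝔼 p
  have hφ₀a : φ₀ ∈ atlas 𝔼 M := chart_mem_atlas 𝔼 p
  have h1 : gradNormSq g u p =
      localGradNormSq (metricCoeff g φ₀) (fun z => u (φ₀.symm z)) (φ₀ p) := rfl
  have h2 := (isIsometryOn_transition g hφ₀a hφ).localGradNormSq (isMetricOn_transition g hφ₀a φ)
    (f := fun z => u (φ₀.symm z)) (f' := fun z => u (φ.symm z))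
    (fun y hy => contDiffAt_comp_chart_symm hu hφ hy) (fun y hy => by
      rw [OpenPartialHomeomorph.trans_source] at hy
      exact congrArg u (φ.left_inv hy.2).symm) (mem_transition_source hp₀ hp)
  rw [h1, h2, Function.comp_apply, φ₀.left_inv hp₀]

theorem scalarCurvL_eq (g : SmoothMetric n M) (u : M → ℝ) (p : M) :
    scalarCurvL g u p = scalarCurv g p - 2 * gradNormSq g u p := by
  set φ := chartAt 𝔼 p with hφ
  have hG := isMetricOn_metricCoeff g (chart_mem_atlas 𝔼 p)
  exact scalarContraction_sub_gradient (hG.symm _)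
    (hG.det_ne_zero (φ.map_source (mem_chart_source 𝔼 p))) (riemCoeff g φ (φ p))
    (duCoeff u φ (φ p))

theorem scalarCurvWY_eq (g : SmoothMetric n M) {u : M → ℝ} (hu : ContMDiff (𝓡 n) 𝓘(ℝ, ℝ) ∞ u)
    (p : M) : scalarCurvWY g u p = scalarCurv g p +
      ((n : ℝ) - 1) * (gradNormSq g u p + laplacian g u p) := by
  have hp := mem_chart_source 𝔼 p
  have hφ := chart_mem_atlas 𝔼 p
  rw [scalarCurv_eq g hφ hp, gradNormSq_eq g hu hφ hp, laplacian_eq g hu hφ hp]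
  exact localScalar_weighted (isMetricOn_metricCoeff g hφ) ((chartAt 𝔼 p).map_source hp)
    (contDiffAt_comp_chart_symm hu hφ ((chartAt 𝔼 p).map_source hp))

theorem gradNormSq_nonneg (g : SmoothMetric n M) (u : M → ℝ) (p : M) : 0 ≤ gradNormSq g u p :=
  contraction_gradForm_nonneg ((isMetricOn_metricCoeff g (chart_mem_atlas 𝔼 p)).posDef _
    ((chartAt 𝔼 p).map_source (mem_chart_source 𝔼 p))) _ _

lemma continuousAt_contraction {G : 𝔼 → Matrix (Fin n) (Fin n) ℝ} {U : Set 𝔼}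
    (hG : IsMetricOn G U) {y : 𝔼} (hy : y ∈ U) {T : 𝔼 → 𝔼 → 𝔼 → ℝ}
    (hT : ∀ i j, ContinuousAt (fun z => T z (stdVec i) (stdVec j)) y) :
    ContinuousAt (fun z => contraction (G z) (T z)) y := by
  unfold contraction
  refine tendsto_finsetSum _ fun i _ => tendsto_finsetSum _ fun j _ => ?_
  exact (contDiffAt_inv (hG.contDiffAt y hy) (hG.det_ne_zero hy) i j).continuousAt.mul (hT i j)

lemma continuousAt_localScalar {G : 𝔼 → Matrix (Fin n) (Fin n) ℝ} {U : Set 𝔼}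
    (hG : IsMetricOn G U) {y : 𝔼} (hy : y ∈ U) : ContinuousAt (localScalar G) y := by
  refine continuousAt_contraction hG hy fun j k => ?_
  simp only [ricciForm_apply]
  have hC := contDiffAt_leviCivita (hG.contDiffAt y hy) (hG.det_ne_zero hy)
  have hCc := hC.continuousAt
  have hDc := (hC.fderiv_right (m := ∞) le_rfl).continuousAt
  have h1 : ∀ a b c, ContinuousAt (fun z => fderiv ℝ (leviCivita G) z a b c) y := fun a b c =>
    ((hDc.clm_apply continuousAt_const).clm_apply continuousAt_const).clm_apply continuousAt_const
  have h2 : ∀ a b c, ContinuousAt (fun z => leviCivita G z a (leviCivita G z b c)) y :=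
    fun a b c => (hCc.clm_apply continuousAt_const).clm_apply
      ((hCc.clm_apply continuousAt_const).clm_apply continuousAt_const)
  refine tendsto_finsetSum _ fun i _ => ?_
  have h3 : ContinuousAt
      (fun z => curvatureAt (leviCivita G) z (stdVec i) (stdVec j) (stdVec k)) y :=
    (((h1 _ _ _).sub (h1 _ _ _)).add (h2 _ _ _)).sub (h2 _ _ _)
  exact (EuclideanSpace.proj i : 𝔼 →L[ℝ] ℝ).continuous.continuousAt.comp h3

lemma continuousAt_localGradNormSq {G : 𝔼 → Matrix (Fin n) (Fin n) ℝ} {U : Set 𝔼}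
    (hG : IsMetricOn G U) {y : 𝔼} (hy : y ∈ U) {f : 𝔼 → ℝ} (hf : ContDiffAt ℝ ∞ f y) :
    ContinuousAt (localGradNormSq G f) y := by
  refine continuousAt_contraction hG hy fun i j => ?_
  have h := (hf.fderiv_right (m := ∞) le_rfl).continuousAt
  exact (h.clm_apply continuousAt_const).mul (h.clm_apply continuousAt_const)

lemma continuousAt_localLaplacian {G : 𝔼 → Matrix (Fin n) (Fin n) ℝ} {U : Set 𝔼}
    (hG : IsMetricOn G U) {y : 𝔼} (hy : y ∈ U) {f : 𝔼 → ℝ} (hf : ContDiffAt ℝ ∞ f y) :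
    ContinuousAt (localLaplacian G f) y := by
  refine continuousAt_contraction hG hy fun i j => ?_
  have h := hf.fderiv_right (m := ∞) le_rfl
  have h2 := (h.fderiv_right (m := ∞) le_rfl).continuousAt
  have hC := (contDiffAt_leviCivita (hG.contDiffAt y hy) (hG.det_ne_zero hy)).continuousAt
  exact ((h2.clm_apply continuousAt_const).clm_apply continuousAt_const).sub
    (h.continuousAt.clm_apply ((hC.clm_apply continuousAt_const).clm_apply continuousAt_const))

theorem continuous_scalarCurv (g : SmoothMetric n M) : Continuous (scalarCurv g) :=
  continuous_of_forall_chart (fun _ hφ _ hp => scalarCurv_eq g hφ hp)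
    fun _ hφ _ hy => continuousAt_localScalar (isMetricOn_metricCoeff g hφ) hy

theorem continuous_gradNormSq (g : SmoothMetric n M) {u : M → ℝ}
    (hu : ContMDiff (𝓡 n) 𝓘(ℝ, ℝ) ∞ u) : Continuous (gradNormSq g u) :=
  continuous_of_forall_chart (fun _ hφ _ hp => gradNormSq_eq g hu hφ hp)
    fun _ hφ _ hy => continuousAt_localGradNormSq (isMetricOn_metricCoeff g hφ) hy
      (contDiffAt_comp_chart_symm hu hφ hy)

theorem continuous_laplacian (g : SmoothMetric n M) {u : M → ℝ}
    (hu : ContMDiff (𝓡 n) 𝓘(ℝ, ℝ) ∞ u) : Continuous (laplacian g u) :=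
  continuous_of_forall_chart (fun _ hφ _ hp => laplacian_eq g hu hφ hp)
    fun _ hφ _ hy => continuousAt_localLaplacian (isMetricOn_metricCoeff g hφ) hy
      (contDiffAt_comp_chart_symm hu hφ hy)

end ScalarQuantities

/-! ### Change of charts for the volume; the finite partition of unity -/

section ChartMeasure

variable {M : Type*} [TopologicalSpace M] [ChartedSpace (EuclideanSpace ℝ (Fin n)) M]
  [IsManifold (𝓡 n) ∞ M]

lemma continuousOn_sqrt_det (g : SmoothMetric n M) {φ : OpenPartialHomeomorph M 𝔼}
    (hφ : φ ∈ atlas 𝔼 M) : ContinuousOn (fun y => √(metricCoeff g φ y).det) φ.target :=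
  fun y hy => (contDiffAt_det
    ((isMetricOn_metricCoeff g hφ).contDiffAt y hy)).continuousAt.sqrt.continuousWithinAt

lemma aemeasurable_sqrt_det (g : SmoothMetric n M) {φ : OpenPartialHomeomorph M 𝔼}
    (hφ : φ ∈ atlas 𝔼 M) : AEMeasurable (fun y => ENNReal.ofReal √(metricCoeff g φ y).det)
      (volume.restrict φ.target) :=
  ((continuousOn_sqrt_det g hφ).aemeasurable φ.open_target.measurableSet).ennreal_ofReal

/-- The volume does not depend on the chart. -/
theorem lintegral_chart_eq (g : SmoothMetric n M) {φ φ' : OpenPartialHomeomorph M 𝔼}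
    (hφ : φ ∈ atlas 𝔼 M) (hφ' : φ' ∈ atlas 𝔼 M) {F : M → ENNReal}
    (hF : ∀ p, p ∉ φ.source ∩ φ'.source → F p = 0) :
    ∫⁻ y in φ.target, ENNReal.ofReal √(metricCoeff g φ y).det * F (φ.symm y) =
      ∫⁻ y in φ'.target, ENNReal.ofReal √(metricCoeff g φ' y).det * F (φ'.symm y) := by
  set U := (φ.symm.trans φ').source with hU
  set ψ := φ' ∘ φ.symm with hψ
  have hiso := isIsometryOn_transition g hφ hφ'
  have hUo : IsOpen U := (φ.symm.trans φ').open_source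
  have hUs : U = φ.target ∩ φ.symm ⁻¹' φ'.source := OpenPartialHomeomorph.trans_source _ _
  have himg : ψ '' U = φ'.target ∩ φ'.symm ⁻¹' φ.source := by
    have h1 := (φ.symm.trans φ').image_source_eq_target
    rw [OpenPartialHomeomorph.trans_target] at h1
    exact h1
  have e1 : ∫⁻ y in φ.target, ENNReal.ofReal √(metricCoeff g φ y).det * F (φ.symm y) =
      ∫⁻ y in U, ENNReal.ofReal √(metricCoeff g φ y).det * F (φ.symm y) := by
    rw [← lintegral_indicator φ.open_target.measurableSet, ← lintegral_indicator hUo.measurableSet]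
    refine lintegral_congr fun y => ?_
    by_cases hy : y ∈ U
    · rw [Set.indicator_of_mem hy, Set.indicator_of_mem (hUs ▸ hy).1]
    · rw [Set.indicator_of_notMem hy]
      by_cases hy' : y ∈ φ.target
      · rw [Set.indicator_of_mem hy', hF, mul_zero]
        exact fun h => hy (hUs ▸ ⟨hy', h.2⟩)
      · rw [Set.indicator_of_notMem hy']
  have hVm : MeasurableSet (φ'.target ∩ φ'.symm ⁻¹' φ.source) := by
    have := (φ'.symm.trans φ).open_source
    rw [OpenPartialHomeomorph.trans_source] at this
    exact this.measurableSet
  have e2 : ∫⁻ y in φ'.target, ENNReal.ofReal √(metricCoeff g φ' y).det * F (φ'.symm y) =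
      ∫⁻ y in ψ '' U, ENNReal.ofReal √(metricCoeff g φ' y).det * F (φ'.symm y) := by
    rw [himg, ← lintegral_indicator φ'.open_target.measurableSet, ← lintegral_indicator hVm]
    refine lintegral_congr fun y => ?_
    by_cases hy : y ∈ φ'.target ∩ φ'.symm ⁻¹' φ.source
    · rw [Set.indicator_of_mem hy, Set.indicator_of_mem hy.1]
    · rw [Set.indicator_of_notMem hy]
      by_cases hy' : y ∈ φ'.target
      · rw [Set.indicator_of_mem hy', hF, mul_zero]
        exact fun h => hy ⟨hy', h.1⟩
      · rw [Set.indicator_of_notMem hy']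
  rw [e1, e2, lintegral_image_eq_lintegral_abs_det_fderiv_mul volume hUo.measurableSet
    (fun y hy => ((hiso.contDiffAt y hy).differentiableAt
      (by simp)).hasFDerivAt.hasFDerivWithinAt) (φ.symm.trans φ').injOn]
  refine setLIntegral_congr_fun hUo.measurableSet fun y hy => ?_
  have hy' := hUs ▸ hy
  have h1 : φ'.symm (ψ y) = φ.symm y := φ'.left_inv hy'.2
  -- The square root of `det g = (det dψ)² det g'` supplies exactly the Jacobian of the change of
  -- variables.
  have h2 : √(metricCoeff g φ y).det =
      |(fderiv ℝ ψ y).det| * √(metricCoeff g φ' (ψ y)).det := by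
    rw [det_transform (hiso.metric y hy), Real.sqrt_mul (sq_nonneg _), Real.sqrt_sq_eq_abs]
  rw [h1, h2, ENNReal.ofReal_mul (abs_nonneg _), mul_assoc]

variable [T2Space M] [CompactSpace M]

/-- A locally finite family on a compact space has finitely many nonempty members; the sum of
measures over all points of `M` thus becomes finite. -/
lemma finite_chartPartition :
    {c : M | (Function.support (chartPartition n M c)).Nonempty}.Finite :=
  (chartPartition n M).locallyFinite.finite_nonempty_of_compact

variable (n M) in
/-- The finitely many charts that contribute to the partition of unity. -/
def activeCharts : Finset M := (finite_chartPartition (n := n) (M := M)).toFinset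

lemma chartPartition_eq_zero {c : M} (hc : c ∉ activeCharts n M) (p : M) :
    chartPartition n M c p = 0 := by
  by_contra h
  exact hc ((Set.Finite.mem_toFinset _).2 ⟨p, h⟩)

lemma sum_chartPartition (p : M) : ∑ c ∈ activeCharts n M, chartPartition n M c p = 1 := by
  rw [← (chartPartition n M).sum_eq_one (Set.mem_univ p)]
  refine (finsum_eq_sum_of_support_subset _ fun c hc => ?_).symm
  by_contra h
  exact hc (chartPartition_eq_zero h p)

lemma chartPartition_eq_zero_of_notMem {c p : M} (hp : p ∉ (chartAt 𝔼 c).source) :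
    chartPartition n M c p = 0 :=
  image_eq_zero_of_notMem_tsupport fun h => hp (chartPartition_isSubordinate n M c h)

end ChartMeasure

/-! ### The Riemannian volume measure -/

section Volume

variable {M : Type*} [TopologicalSpace M] [MeasurableSpace M] [BorelSpace M]

lemma aemeasurable_chart_symm (φ : OpenPartialHomeomorph M 𝔼) :
    AEMeasurable φ.symm (volume.restrict φ.target) :=
  φ.symm.continuousOn.aemeasurable φ.open_target.measurableSet

lemma lintegral_map_chart_symm (φ : OpenPartialHomeomorph M 𝔼) {ρ : 𝔼 → ENNReal}
    (hρ : AEMeasurable ρ (volume.restrict φ.target)) {F : M → ENNReal} (hF : Measurable F) :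
    ∫⁻ p, F p ∂(Measure.map φ.symm ((volume.restrict φ.target).withDensity ρ)) =
      ∫⁻ y in φ.target, ρ y * F (φ.symm y) := by
  have h1 : AEMeasurable φ.symm ((volume.restrict φ.target).withDensity ρ) :=
    (aemeasurable_chart_symm φ).mono_ac (withDensity_absolutelyContinuous _ _)
  rw [lintegral_map' hF.aemeasurable h1]
  exact lintegral_withDensity_eq_lintegral_mul₀' hρ (hF.comp_aemeasurable h1)

variable [ChartedSpace (EuclideanSpace ℝ (Fin n)) M] [IsManifold (𝓡 n) ∞ M]

/-- The Riemannian volume measure of the domain of a chart. -/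
def chartVolume (g : SmoothMetric n M) (φ : OpenPartialHomeomorph M 𝔼) : Measure M :=
  Measure.map φ.symm ((volume.restrict φ.target).withDensity fun y =>
    ENNReal.ofReal √(metricCoeff g φ y).det)

variable [T2Space M] [CompactSpace M]

lemma measurable_chartPartition (c : M) :
    Measurable fun p => ENNReal.ofReal (chartPartition n M c p) :=
  (chartPartition n M c).contMDiff.continuous.measurable.ennreal_ofReal

lemma aemeasurable_density (g : SmoothMetric n M) (c : M) :
    AEMeasurable (fun y => ENNReal.ofReal (chartPartition n M c ((chartAt 𝔼 c).symm y) *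
      √(metricCoeff g (chartAt 𝔼 c) y).det)) (volume.restrict (chartAt 𝔼 c).target) := by
  simp only [ENNReal.ofReal_mul ((chartPartition n M).nonneg c _)]
  exact ((measurable_chartPartition c).comp_aemeasurable (aemeasurable_chart_symm _)).mul
    (aemeasurable_sqrt_det g (chart_mem_atlas 𝔼 c))

lemma lintegral_riemannianVolume (g : SmoothMetric n M) {F : M → ENNReal} (hF : Measurable F) :
    ∫⁻ p, F p ∂(riemannianVolume g) = ∑ c ∈ activeCharts n M, ∫⁻ y in (chartAt 𝔼 c).target,
      ENNReal.ofReal √(metricCoeff g (chartAt 𝔼 c) y).det *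
        (ENNReal.ofReal (chartPartition n M c ((chartAt 𝔼 c).symm y)) *
          F ((chartAt 𝔼 c).symm y)) := by
  rw [riemannianVolume, lintegral_sum_measure]
  simp only [lintegral_map_chart_symm _ (aemeasurable_density g _) hF]
  rw [tsum_eq_sum (s := activeCharts n M)]
  · refine Finset.sum_congr rfl fun c _ => lintegral_congr fun y => ?_
    rw [ENNReal.ofReal_mul ((chartPartition n M).nonneg c _), mul_right_comm, mul_comm]
  · intro c hc
    simp [chartPartition_eq_zero hc]

/-- In the domain of a chart the volume measure is `√(det g) dy`. -/
theorem riemannianVolume_restrict (g : SmoothMetric n M) {φ : OpenPartialHomeomorph M 𝔼}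
    (hφ : φ ∈ atlas 𝔼 M) :
    (riemannianVolume g).restrict φ.source = chartVolume g φ := by
  have key : ∀ F : M → ENNReal, Measurable F → (∀ p ∉ φ.source, F p = 0) →
      ∫⁻ p, F p ∂(riemannianVolume g) = ∫⁻ p, F p ∂(chartVolume g φ) := by
    intro F hF h0
    rw [lintegral_riemannianVolume g hF, chartVolume,
      lintegral_map_chart_symm φ (aemeasurable_sqrt_det g hφ) hF]
    -- Each piece is moved to the one chart `φ`: its integrand vanishes off `φ.source` through `F`,
    -- and off the chart at `c` through the partition function.
    have h1 : ∀ c : M, ∫⁻ y in (chartAt 𝔼 c).target,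
        ENNReal.ofReal √(metricCoeff g (chartAt 𝔼 c) y).det *
          (ENNReal.ofReal (chartPartition n M c ((chartAt 𝔼 c).symm y)) *
            F ((chartAt 𝔼 c).symm y)) =
        ∫⁻ y in φ.target, ENNReal.ofReal √(metricCoeff g φ y).det *
          (ENNReal.ofReal (chartPartition n M c (φ.symm y)) * F (φ.symm y)) := fun c =>
      lintegral_chart_eq g (chart_mem_atlas 𝔼 c) hφ
        (F := fun p => ENNReal.ofReal (chartPartition n M c p) * F p) fun p hp => by
          by_cases hpc : p ∈ (chartAt 𝔼 c).source
          · rw [h0 p fun h => hp ⟨hpc, h⟩, mul_zero]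
          · rw [chartPartition_eq_zero_of_notMem hpc, ENNReal.ofReal_zero, zero_mul]
    simp only [h1]
    have h2 : ∀ c ∈ activeCharts n M, AEMeasurable (fun y =>
        ENNReal.ofReal √(metricCoeff g φ y).det *
          (ENNReal.ofReal (chartPartition n M c (φ.symm y)) * F (φ.symm y)))
        (volume.restrict φ.target) := fun c _ => (aemeasurable_sqrt_det g hφ).mul
      (((measurable_chartPartition c).mul hF).comp_aemeasurable (aemeasurable_chart_symm φ))
    rw [← lintegral_finsetSum' _ h2]
    refine lintegral_congr fun y => ?_
    rw [← Finset.mul_sum, ← Finset.sum_mul,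
      ← ENNReal.ofReal_sum_of_nonneg fun c _ => (chartPartition n M).nonneg c _,
      sum_chartPartition, ENNReal.ofReal_one, one_mul]
  -- `key` compares the measures only inside `φ.source`; the pushforward must also not charge the
  -- complement.
  have hnull : chartVolume g φ φ.sourceᶜ = 0 := by
    have h := lintegral_map_chart_symm φ (aemeasurable_sqrt_det g hφ)
      (measurable_one.indicator φ.open_source.measurableSet.compl)
    rw [lintegral_indicator_one φ.open_source.measurableSet.compl] at h
    rw [chartVolume, h]
    refine (setLIntegral_congr_fun φ.open_target.measurableSet fun y hy => ?_).trans lintegral_zero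
    have : φ.symm y ∉ φ.sourceᶜ := fun h => h (φ.map_target hy)
    simp [Set.indicator_of_notMem this]
  ext s hs
  rw [Measure.restrict_apply hs]
  have hm := hs.inter φ.open_source.measurableSet
  rw [← lintegral_indicator_one hm, key _ (measurable_one.indicator hm) fun p hp =>
    Set.indicator_of_notMem (fun h => hp h.2) _, lintegral_indicator_one hm]
  exact measure_inter_conull hnull

/-- `√det g` may be unbounded on a whole chart, but each partition function restricts the integral
to the compact image of its support, where the density is continuous. -/
instance isFiniteMeasure_riemannianVolume (g : SmoothMetric n M) :
    IsFiniteMeasure (riemannianVolume g) := by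
  refine ⟨?_⟩
  rw [← lintegral_one, lintegral_riemannianVolume g measurable_const]
  refine ENNReal.sum_lt_top.2 fun c _ => ?_
  set φ := chartAt 𝔼 c with hφ
  have hφa : φ ∈ atlas 𝔼 M := chart_mem_atlas 𝔼 c
  set K := φ '' tsupport (chartPartition n M c) with hK
  have hsub : tsupport (chartPartition n M c) ⊆ φ.source := chartPartition_isSubordinate n M c
  have hKc : IsCompact K := (isClosed_tsupport _).isCompact.image_of_continuousOn
    (φ.continuousOn.mono hsub)
  have hKt : K ⊆ φ.target := by
    rintro _ ⟨p, hp, rfl⟩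
    exact φ.map_source (hsub hp)
  have hcont : ContinuousOn (fun y => √(metricCoeff g φ y).det * chartPartition n M c (φ.symm y))
      K := (((continuousOn_sqrt_det g hφa)).mul
        ((chartPartition n M c).contMDiff.continuous.comp_continuousOn
          φ.symm.continuousOn)).mono hKt
  have hlt := (hcont.integrableOn_compact (μ := volume) hKc).lintegral_lt_top
  refine lt_of_le_of_lt ?_ hlt
  rw [← lintegral_indicator φ.open_target.measurableSet,
    ← lintegral_indicator hKc.isClosed.measurableSet]
  refine lintegral_mono fun y => ?_
  by_cases hy : y ∈ K
  · rw [Set.indicator_of_mem hy, Set.indicator_of_mem (hKt hy), mul_one,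
      ENNReal.ofReal_mul (Real.sqrt_nonneg _)]
  · by_cases hy' : y ∈ φ.target
    · have h2 : chartPartition n M c (φ.symm y) = 0 :=
        image_eq_zero_of_notMem_tsupport fun h => hy ⟨_, h, φ.right_inv hy'⟩
      rw [Set.indicator_of_mem hy', h2]
      simp
    · rw [Set.indicator_of_notMem hy']
      exact zero_le

lemma integral_riemannianVolume_of_chart (g : SmoothMetric n M) {φ : OpenPartialHomeomorph M 𝔼}
    (hφ : φ ∈ atlas 𝔼 M) {f : M → ℝ} (hf : Continuous f) (h0 : ∀ p ∉ φ.source, f p = 0) :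
    ∫ p, f p ∂(riemannianVolume g) =
      ∫ y in φ.target, √(metricCoeff g φ y).det * f (φ.symm y) := by
  rw [← setIntegral_eq_integral_of_forall_compl_eq_zero h0, riemannianVolume_restrict g hφ,
    chartVolume, integral_map ((aemeasurable_chart_symm φ).mono_ac
      (withDensity_absolutelyContinuous _ _)) hf.measurable.aestronglyMeasurable,
    integral_withDensity_eq_integral_toReal_smul₀ (aemeasurable_sqrt_det g hφ)
      (Eventually.of_forall fun _ => ENNReal.ofReal_lt_top)]
  simp [ENNReal.toReal_ofReal, Real.sqrt_nonneg]

end Volume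

lemma integrable_of_continuous {M : Type*} [TopologicalSpace M] [CompactSpace M] [MeasurableSpace M]
    [BorelSpace M] {f : M → ℝ} (hf : Continuous f) (μ : Measure M)
    [IsFiniteMeasure μ] : Integrable f μ :=
  hf.integrable_of_hasCompactSupport (HasCompactSupport.of_compactSpace f)

/-! ### Locality, additivity and the exponential rule for the Laplacian -/

section LaplacianRules

lemma localLaplacian_congr {G : 𝔼 → Matrix (Fin n) (Fin n) ℝ} {f f' : 𝔼 → ℝ} {y : 𝔼}
    (h : f =ᶠ[𝓝 y] f') : localLaplacian G f y = localLaplacian G f' y := by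
  simp only [localLaplacian, hessianForm, h.fderiv_eq, h.fderiv.fderiv_eq]

lemma localLaplacian_add (G : 𝔼 → Matrix (Fin n) (Fin n) ℝ) {f f' : 𝔼 → ℝ} {y : 𝔼}
    (hf : ContDiffAt ℝ ∞ f y) (hf' : ContDiffAt ℝ ∞ f' y) :
    localLaplacian G (fun z => f z + f' z) y = localLaplacian G f y + localLaplacian G f' y := by
  have hev : ∀ {f : 𝔼 → ℝ}, ContDiffAt ℝ ∞ f y → ∀ᶠ z in 𝓝 y, DifferentiableAt ℝ f z := fun h =>
    ((h.of_le (natCast_le_infty 2)).eventually (by norm_num)).mono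
      fun z hz => hz.differentiableAt (by norm_num)
  have hd : ∀ {f : 𝔼 → ℝ}, ContDiffAt ℝ ∞ f y → DifferentiableAt ℝ (fderiv ℝ f) y := fun h =>
    (h.fderiv_right (m := 1) (natCast_le_infty 2)).differentiableAt (by norm_num)
  have h1 : fderiv ℝ (fun z => f z + f' z) =ᶠ[𝓝 y] fun z => fderiv ℝ f z + fderiv ℝ f' z := by
    filter_upwards [hev hf, hev hf'] with z hz hz'
    exact fderiv_fun_add hz hz'
  have h2 : ∀ v w, hessianForm G (fun z => f z + f' z) y v w =
      hessianForm G f y v w + hessianForm G f' y v w := by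
    intro v w
    simp only [hessianForm_apply, h1.fderiv_eq, h1.self_of_nhds]
    rw [fderiv_fun_add (hd hf) (hd hf')]
    simp only [_root_.add_apply]
    ring
  simp only [localLaplacian, contraction, h2, mul_add, Finset.sum_add_distrib]

/-- From `d(exp f) = exp f df` one gets `Hess(exp f) = exp f (Hess f + df ⊗ df)`. This is the same
tensor that appears in the weighted curvature, hence the equality for the weight `exp u`. -/
lemma localLaplacian_exp (G : 𝔼 → Matrix (Fin n) (Fin n) ℝ) {f : 𝔼 → ℝ} {y : 𝔼}
    (hf : ContDiffAt ℝ ∞ f y) :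
    localLaplacian G (fun z => Real.exp (f z)) y =
      (localGradNormSq G f y + localLaplacian G f y) * Real.exp (f y) := by
  have h1 : fderiv ℝ (fun z => Real.exp (f z)) =ᶠ[𝓝 y] fun z => Real.exp (f z) • fderiv ℝ f z := by
    filter_upwards [(hf.of_le (natCast_le_infty 2)).eventually (by norm_num)] with z hz
    exact (hz.differentiableAt (by norm_num)).hasFDerivAt.exp.fderiv
  have hd : DifferentiableAt ℝ (fderiv ℝ f) y :=
    (hf.fderiv_right (m := 1) (natCast_le_infty 2)).differentiableAt (by norm_num)
  have h2 : ∀ v w, hessianForm G (fun z => Real.exp (f z)) y v w =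
      (gradForm f y v w + hessianForm G f y v w) * Real.exp (f y) := by
    intro v w
    have h3 := (hf.differentiableAt (by simp)).hasFDerivAt.exp.smul hd.hasFDerivAt
    simp only [hessianForm_apply, gradForm_apply, (h3.congr_of_eventuallyEq h1).fderiv,
      h1.self_of_nhds]
    simp
    ring
  simp only [localLaplacian, localGradNormSq, contraction, h2, add_mul, Finset.sum_mul,
    ← Finset.sum_add_distrib]
  exact Finset.sum_congr rfl fun i _ => Finset.sum_congr rfl fun j _ => by ring

variable {M : Type*} [TopologicalSpace M] [ChartedSpace (EuclideanSpace ℝ (Fin n)) M]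
  [IsManifold (𝓡 n) ∞ M]

lemma laplacian_add (g : SmoothMetric n M) {f f' : M → ℝ} (hf : ContMDiff (𝓡 n) 𝓘(ℝ, ℝ) ∞ f)
    (hf' : ContMDiff (𝓡 n) 𝓘(ℝ, ℝ) ∞ f') (p : M) :
    laplacian g (fun q => f q + f' q) p = laplacian g f p + laplacian g f' p := by
  have hφ := chart_mem_atlas 𝔼 p
  have hy := (chartAt 𝔼 p).map_source (mem_chart_source 𝔼 p)
  have hadd : ContMDiff (𝓡 n) 𝓘(ℝ, ℝ) ∞ fun q => f q + f' q := hf.add hf'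
  rw [laplacian_eq_chartAt g hadd, laplacian_eq_chartAt g hf, laplacian_eq_chartAt g hf']
  exact localLaplacian_add _ (contDiffAt_comp_chart_symm hf hφ hy)
    (contDiffAt_comp_chart_symm hf' hφ hy)

lemma laplacian_exp (g : SmoothMetric n M) {u : M → ℝ} (hu : ContMDiff (𝓡 n) 𝓘(ℝ, ℝ) ∞ u)
    (p : M) : laplacian g (fun q => Real.exp (u q)) p =
      (gradNormSq g u p + laplacian g u p) * Real.exp (u p) := by
  have hφ := chart_mem_atlas 𝔼 p
  have hp := mem_chart_source 𝔼 p
  have hy := (chartAt 𝔼 p).map_source hp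
  have hexp : ContMDiff (𝓡 n) 𝓘(ℝ, ℝ) ∞ fun q => Real.exp (u q) :=
    Real.contDiff_exp.contMDiff.comp hu
  rw [laplacian_eq_chartAt g hexp, laplacian_eq_chartAt g hu, gradNormSq_eq g hu hφ hp,
    localLaplacian_exp _ (contDiffAt_comp_chart_symm hu hφ hy),
    (chartAt 𝔼 p).left_inv hp]

lemma laplacian_eq_zero (g : SmoothMetric n M) {f : M → ℝ} (hf : ContMDiff (𝓡 n) 𝓘(ℝ, ℝ) ∞ f)
    {p : M} (hp : p ∉ tsupport f) : laplacian g f p = 0 := by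
  rw [laplacian_eq_chartAt g hf]
  refine localLaplacian_eq_zero ?_
  set φ := chartAt 𝔼 p with hφ
  have hps : p ∈ φ.source := mem_chart_source 𝔼 p
  have hc : Tendsto φ.symm (𝓝 (φ p)) (𝓝 p) := by
    have := φ.symm.continuousAt (φ.map_source hps)
    rwa [ContinuousAt, φ.left_inv hps] at this
  exact hc.eventually (notMem_tsupport_iff_eventuallyEq.1 hp)

lemma laplacian_sum (g : SmoothMetric n M) {ι : Type*} (s : Finset ι) {f : ι → M → ℝ}
    (hf : ∀ i, ContMDiff (𝓡 n) 𝓘(ℝ, ℝ) ∞ (f i)) (p : M) :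
    laplacian g (fun q => ∑ i ∈ s, f i q) p = ∑ i ∈ s, laplacian g (f i) p := by
  classical
  induction s using Finset.induction_on with
  | empty =>
    simp only [Finset.sum_empty]
    exact laplacian_eq_zero g contMDiff_const (by simp [tsupport])
  | insert a s ha ih =>
    simp only [Finset.sum_insert ha]
    rw [laplacian_add g (hf a) (contMDiff_finsetSum fun i _ => hf i), ih]

end LaplacianRules

/-! ### The divergence theorem on a closed manifold -/

section Divergence

variable {M : Type*} [TopologicalSpace M] [ChartedSpace (EuclideanSpace ℝ (Fin n)) M]
  [IsManifold (𝓡 n) ∞ M] [CompactSpace M] [T2Space M] [MeasurableSpace M] [BorelSpace M]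

lemma integral_laplacian_eq_zero_of_chart (g : SmoothMetric n M) {f : M → ℝ}
    (hf : ContMDiff (𝓡 n) 𝓘(ℝ, ℝ) ∞ f) {φ : OpenPartialHomeomorph M 𝔼} (hφ : φ ∈ atlas 𝔼 M)
    (hs : tsupport f ⊆ φ.source) : ∫ p, laplacian g f p ∂(riemannianVolume g) = 0 := by
  rw [integral_riemannianVolume_of_chart g hφ (continuous_laplacian g hf)
    fun p hp => laplacian_eq_zero g hf fun h => hp (hs h)]
  -- Outside `φ.target` the values of `φ.symm` carry no meaning, so `f ∘ φ.symm` is replaced by its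
  -- extension by zero, which is smooth because its support lies in a compact subset of the target.
  set h : 𝔼 → ℝ := φ.target.indicator fun y => f (φ.symm y) with hh
  set K := φ '' tsupport f with hK
  have hKc : IsCompact K := (isClosed_tsupport _).isCompact.image_of_continuousOn
    (φ.continuousOn.mono hs)
  have hKt : K ⊆ φ.target := by
    rintro _ ⟨p, hp, rfl⟩
    exact φ.map_source (hs hp)
  have hzero : ∀ y ∉ K, h y = 0 := by
    intro y hy
    by_cases hy' : y ∈ φ.target
    · rw [hh, Set.indicator_of_mem hy']
      exact image_eq_zero_of_notMem_tsupport fun h => hy ⟨_, h, φ.right_inv hy'⟩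
    · exact Set.indicator_of_notMem hy' _
  have hsupp : tsupport h ⊆ K := closure_minimal
    (fun y hy => by by_contra h0; exact hy (hzero y h0)) hKc.isClosed
  have heq : ∀ y ∈ φ.target, h =ᶠ[𝓝 y] fun z => f (φ.symm z) := fun y hy => by
    filter_upwards [φ.open_target.mem_nhds hy] with z hz
    exact Set.indicator_of_mem hz _
  have hsm : ContDiff ℝ ∞ h := contDiff_iff_contDiffAt.2 fun y => by
    by_cases hy : y ∈ φ.target
    · exact (contDiffAt_comp_chart_symm hf hφ hy).congr_of_eventuallyEq (heq y hy)
    · refine contDiffAt_const.congr_of_eventuallyEq (f := fun _ => (0 : ℝ)) ?_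
      exact notMem_tsupport_iff_eventuallyEq.1 fun h0 => hy (hKt (hsupp h0))
  have hint := integral_localLaplacian_eq_zero (isMetricOn_metricCoeff g hφ) hsm
    (hKc.of_isClosed_subset (isClosed_tsupport _) hsupp) (hsupp.trans hKt)
  rw [← setIntegral_eq_integral_of_forall_compl_eq_zero (s := φ.target)] at hint
  · rw [← hint]
    refine setIntegral_congr_fun φ.open_target.measurableSet fun y hy => ?_
    rw [laplacian_eq g hf hφ (φ.map_target hy), φ.right_inv hy, localLaplacian_congr (heq y hy)]
  · intro y hy
    rw [localLaplacian_eq_zero (notMem_tsupport_iff_eventuallyEq.1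
      fun h0 => hy (hKt (hsupp h0))), mul_zero]

/-- The divergence theorem for gradient fields on a closed manifold. -/
theorem integral_laplacian_eq_zero (g : SmoothMetric n M) {f : M → ℝ}
    (hf : ContMDiff (𝓡 n) 𝓘(ℝ, ℝ) ∞ f) : ∫ p, laplacian g f p ∂(riemannianVolume g) = 0 := by
  have hsm : ∀ c : M, ContMDiff (𝓡 n) 𝓘(ℝ, ℝ) ∞ fun p => chartPartition n M c p * f p :=
    fun c => (chartPartition n M c).contMDiff.mul hf
  -- Multiplying by the partition functions, rather than splitting the integral, keeps every summand
  -- a Laplacian of a function supported in one chart.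
  have hdec : f = fun p => ∑ c ∈ activeCharts n M, chartPartition n M c p * f p := by
    ext p
    rw [← Finset.sum_mul, sum_chartPartition, one_mul]
  have hlap : ∀ p, laplacian g f p =
      ∑ c ∈ activeCharts n M, laplacian g (fun q => chartPartition n M c q * f q) p := by
    intro p
    rw [← laplacian_sum g _ hsm, ← hdec]
  simp only [hlap]
  rw [integral_finsetSum _ fun c _ => integrable_of_continuous (continuous_laplacian g (hsm c)) _]
  refine Finset.sum_eq_zero fun c _ => ?_
  exact integral_laplacian_eq_zero_of_chart g (hsm c) (chart_mem_atlas 𝔼 c)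
    ((tsupport_mul_subset_left).trans (chartPartition_isSubordinate n M c))

end Divergence

end WeightedScalar

end

/-! ### The main theorem -/

theorem proposition1p8 {n : ℕ} {M : Type*} [TopologicalSpace M]
    [ChartedSpace (EuclideanSpace ℝ (Fin n)) M] [IsManifold (𝓡 n) ∞ M]
    [CompactSpace M] [T2Space M] [MeasurableSpace M] [BorelSpace M]
    (g : WeightedScalar.SmoothMetric n M) (u : M → ℝ) (hu : ContMDiff (𝓡 n) 𝓘(ℝ, ℝ) ∞ u) :
    -- the three scalar curvatures
    (∀ p : M, WeightedScalar.scalarCurvL g u p =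
      WeightedScalar.scalarCurv g p - 2 * WeightedScalar.gradNormSq g u p) ∧
    (∀ p : M, WeightedScalar.scalarCurvWY g u p = WeightedScalar.scalarCurv g p +
      ((n : ℝ) - 1) * (WeightedScalar.gradNormSq g u p + WeightedScalar.laplacian g u p)) ∧
    -- comparison of `R^L` and `R` for an arbitrary measure
    (∀ μ : Measure M, Integrable (WeightedScalar.scalarCurvL g u) μ →
      Integrable (WeightedScalar.scalarCurv g) μ →
      ∫ p, WeightedScalar.scalarCurvL g u p ∂μ ≤ ∫ p, WeightedScalar.scalarCurv g p ∂μ) ∧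
    -- every finite measure is admissible there
    (∀ μ : Measure M, IsFiniteMeasure μ → Integrable (WeightedScalar.scalarCurvL g u) μ ∧
      Integrable (WeightedScalar.scalarCurv g) μ) ∧
    -- comparison of `R` and `R^WY` for the volume measure
    (Integrable (WeightedScalar.scalarCurv g) (WeightedScalar.riemannianVolume g) ∧
      Integrable (WeightedScalar.scalarCurvWY g u) (WeightedScalar.riemannianVolume g) ∧
      ∫ p, WeightedScalar.scalarCurv g p ∂(WeightedScalar.riemannianVolume g) ≤
        ∫ p, WeightedScalar.scalarCurvWY g u p ∂(WeightedScalar.riemannianVolume g)) ∧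
    -- equality for the weighted volume measure
    (Integrable (fun p => WeightedScalar.scalarCurv g p * Real.exp (u p))
        (WeightedScalar.riemannianVolume g) ∧
      Integrable (fun p => WeightedScalar.scalarCurvWY g u p * Real.exp (u p))
        (WeightedScalar.riemannianVolume g) ∧
      ∫ p, WeightedScalar.scalarCurv g p * Real.exp (u p) ∂(WeightedScalar.riemannianVolume g) =
        ∫ p, WeightedScalar.scalarCurvWY g u p * Real.exp (u p)
          ∂(WeightedScalar.riemannianVolume g)) := by
  have hRc := WeightedScalar.continuous_scalarCurv g
  have hGc := WeightedScalar.continuous_gradNormSq g hu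
  have hΔc := WeightedScalar.continuous_laplacian g hu
  have hec : Continuous fun p => Real.exp (u p) := Real.continuous_exp.comp hu.continuous
  have hL := WeightedScalar.scalarCurvL_eq g u
  have hWY := WeightedScalar.scalarCurvWY_eq g hu
  have hLc : Continuous (WeightedScalar.scalarCurvL g u) := by
    rw [show WeightedScalar.scalarCurvL g u = _ from funext hL]
    exact hRc.sub (continuous_const.mul hGc)
  have hWYc : Continuous (WeightedScalar.scalarCurvWY g u) := by
    rw [show WeightedScalar.scalarCurvWY g u = _ from funext hWY]
    exact hRc.add (continuous_const.mul (hGc.add hΔc))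
  have hint : ∀ {f : M → ℝ}, Continuous f → Integrable f (WeightedScalar.riemannianVolume g) :=
    fun hf => WeightedScalar.integrable_of_continuous hf _
  refine ⟨hL, hWY, fun μ hLi hRi => ?_, fun μ _ =>
    ⟨WeightedScalar.integrable_of_continuous hLc μ, WeightedScalar.integrable_of_continuous hRc μ⟩,
    ⟨hint hRc, hint hWYc, ?_⟩, hint (hRc.mul hec), hint (hWYc.mul hec), ?_⟩
  · refine integral_mono hLi hRi fun p => ?_
    rw [hL]
    linarith [WeightedScalar.gradNormSq_nonneg g u p]
  · simp only [hWY]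
    have hsum : Integrable (fun p => WeightedScalar.gradNormSq g u p +
        WeightedScalar.laplacian g u p) (WeightedScalar.riemannianVolume g) := hint (hGc.add hΔc)
    rw [integral_add (hint hRc) (hsum.const_mul _), integral_const_mul,
      integral_add (hint hGc) (hint hΔc), WeightedScalar.integral_laplacian_eq_zero g hu, add_zero]
    refine le_add_of_nonneg_right ?_
    -- In dimension zero the factor `n - 1` is `-1`, but the gradient norm is an empty sum.
    rcases Nat.eq_zero_or_pos n with rfl | hn
    · have : WeightedScalar.gradNormSq g u = 0 := by
        ext p
        simp [WeightedScalar.gradNormSq]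
      simp [this]
    · refine mul_nonneg ?_ (integral_nonneg (WeightedScalar.gradNormSq_nonneg g u))
      have : (1 : ℝ) ≤ n := by exact_mod_cast hn
      linarith
  · have hexp : ContMDiff (𝓡 n) 𝓘(ℝ, ℝ) ∞ fun q => Real.exp (u q) :=
      Real.contDiff_exp.contMDiff.comp hu
    -- The correction term `(|∇u|² + Δu) exp u` is the Laplacian of `exp u`, so its integral
    -- vanishes and the factor `n - 1` plays no role.
    have h0 := WeightedScalar.integral_laplacian_eq_zero g hexp
    simp only [WeightedScalar.laplacian_exp g hu] at h0
    simp only [hWY, add_mul _ _ (Real.exp _), mul_assoc]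
    simp only [← add_mul] at h0 ⊢
    have hRe : Integrable (fun p => WeightedScalar.scalarCurv g p * Real.exp (u p))
        (WeightedScalar.riemannianVolume g) := hint (hRc.mul hec)
    have hsum : Integrable (fun p => (WeightedScalar.gradNormSq g u p +
        WeightedScalar.laplacian g u p) * Real.exp (u p)) (WeightedScalar.riemannianVolume g) :=
      hint ((hGc.add hΔc).mul hec)
    rw [integral_add hRe (hsum.const_mul _),
      integral_const_mul, h0, mul_zero, add_zero]
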